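/- **Setting.** Let $n,m\ge 1$, let $f_1,\dots,f_m:\mathbb R^n\to\mathbb R$, $f=\frac1m\sum_{i=1}^m f_i$, and $x_0\in\mathbb R^n$. Let $\varepsilon>0$, $\varepsilon_g=\varepsilon$, $\varepsilon_h=\sqrt{L_h\varepsilon}$ with $L_h>0$ as below, and let $\hat\mu,\eta>0$, $\bar\delta\in(0,1)$. Norms are Euclidean (spectral for matrices) and $\lambda_{\min}$ is the smallest eigenvalue. **Algorithm.** At iteration $k=0,1,\dots$ draw index batches $\mathcal S_{g,k},\mathcal S_{h,k}$ from $\{1,\dots,m\}$ of prescribed sizes, each uniformly at random, with replacement or (both cases are claimed) without replacement, independently of each other and of everything that happened before iteration $k$, and set $$g_k=\frac1{|\mathcal S_{g,k}|}\sum_{i\in\mathcal S_{g,k}}\nabla f_i(x_k),\qquad Q_k=\frac1{|\mathcal S_{h,k}|}\sum_{i\in\mathcal S_{h,k}}\nabla^2 f_i(x_k).$$ Obtain a unit vector $\hat p_k$ and put $\hat\lambda_k=\hat p_k^\top Q_k\hat p_k$. * If $\hat\lambda_k<-\varepsilon_h$: put $d_k=-\operatorname{sign}(g_k^\top\hat p_k)\,\hat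 p_k$ (where $\operatorname{sign}(0)$ is either of $\pm1$) and $x_{k+1}=x_k+\frac{17}{12L_h}\varepsilon_h d_k$. * If $\hat\lambda_k\ge-\varepsilon_h$ and $\|g_k\|\ge\varepsilon_g$: let $d_k$ be an iterate of the conjugate gradient method for $(Q_k+2\varepsilon_hI)d=-g_k$, started at $0$, with $\|(Q_k+2\varepsilon_hI)d_k+g_k\|\le\hat\mu\varepsilon_h\|d_k\|$. If $\|d_k\|\le 2\varepsilon_g/\varepsilon_h$, terminate and return $x_k+d_k$; otherwise $x_{k+1}=x_k+\alpha_kd_k$ with $\alpha_k=\frac{\sqrt2}{\sqrt{3(L_h+\eta)}\,\|d_k\|}\varepsilon_g^{1/2}$. * If $\hat\lambda_k\ge-\varepsilon_h$ and $\|g_k\|<\varepsilon_g$: terminate and return $x_k$ (put $d_k=0$). **Assumptions.** 1. $f\ge f_*$ on $\mathbb R^n$ for a finite $f_*$, and $\{x: f(x)\le f(x_0)\}$ is bounded. 2. There is an open set $\mathcal B$ that contains all segments $[x_k,x_k+d_k]$ and $[x_k,x_{k+1}]$ generated by the algorithm (the second is contained in the first if the step size is at most $1$), on which all $f_i$ are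 twice differentiable and on which $\nabla f$ and $\nabla^2f$ are Lipschitz continuous with constants $L_g>0$ and $L_h>0$. 3. $\hat\lambda_k-\lambda_{\min}(Q_k)\le\frac12\varepsilon_h$ at every iteration. 4. $\|\nabla f_i(x)\|\le\widehat U_g$ and $\|\nabla^2f_i(x)\|\le\widehat U_h$ for all $i$ and all $x$ with $f(x)\le f(x_0)$, where $0<\widehat U_g,\widehat U_h<\infty$, and for every $k$ $$|\mathcal S_{g,k}|\ge\frac{9\widehat U_g^2\bigl(1+\sqrt{8\ln(1/\bar\delta)}\bigr)^2}{\varepsilon_g^2},\qquad |\mathcal S_{h,k}|\ge\frac{5184\,\widehat U_h^2}{\varepsilon_h^2}\ln\frac{2n}{\bar\delta}.$$ **Theorem.** Let $$\overline K_3=\left\lceil\frac{2(f(x_0)-f_*)}{\min\{c_{nc},c_{sol}\}}\varepsilon^{-3/2}\right\rceil+1,\qquad c_{nc}=\frac{17}{10368\sqrt{L_h}},\qquad c_{sol}=\frac{\sqrt2\,\eta}{9\sqrt3\,(L_h+\eta)^{3/2}}.$$ There is a constant $C>0$ that depends only on $\hat\mu$ such that, with probability at least $(1-\bar\delta)^{\overline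 K_3}$, the algorithm terminates in at most $\overline K_3$ iterations and returns a point $x$ with $$\|\nabla f(x)\|\le C\varepsilon\qquad\text{and}\qquad\lambda_{\min}(\nabla^2f(x))\ge-C\sqrt{L_h\varepsilon}.$$ -/

import Mathlib

open MeasureTheory ProbabilityTheory
open scoped RealInnerProductSpace

noncomputable section

/-- `ℝⁿ` with the Euclidean norm. -/
abbrev Vec (n : ℕ) : Type := EuclideanSpace ℝ (Fin n)

/-- The operators on `ℝⁿ` (the `n × n` matrices), with the spectral norm. -/
abbrev Op (n : ℕ) : Type := Vec n →L[ℝ] Vec n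

/-- The Hessian of `f` at `x`: the derivative of the gradient. -/
def hess {n : ℕ} (f : Vec n → ℝ) (x : Vec n) : Op n := fderiv ℝ (gradient f) x

/-- The smallest eigenvalue of a symmetric operator on `ℝⁿ`, `n ≥ 1`. -/
def lamMin {n : ℕ} (A : Op n) : ℝ :=
  sInf {l : ℝ | Module.End.HasEigenvalue (A : Vec n →ₗ[ℝ] Vec n) l}

/-- The finite-sum objective `(1/m) ∑ᵢ fᵢ`. -/
def finiteSum {n m : ℕ} (f : Fin m → Vec n → ℝ) (x : Vec n) : ℝ :=
  (m : ℝ)⁻¹ * ∑ i, f i x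

/-- `f` is differentiable on `B` and so is its gradient. -/
def TwiceDifferentiableOn {n : ℕ} (f : Vec n → ℝ) (B : Set (Vec n)) : Prop :=
  DifferentiableOn ℝ f B ∧ DifferentiableOn ℝ (gradient f) B

/-! ### Subsampling -/

/-- The subsampled gradient at `x` for a batch of `s` indices. -/
def subGrad {n m s : ℕ} (f : Fin m → Vec n → ℝ) (S : Fin s → Fin m) (x : Vec n) : Vec n :=
  (s : ℝ)⁻¹ • ∑ j, gradient (f (S j)) x

/-- The subsampled Hessian at `x` for a batch of `s` indices. -/
def subHess {n m s : ℕ} (f : Fin m → Vec n → ℝ) (S : Fin s → Fin m) (x : Vec n) : Op n :=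
  (s : ℝ)⁻¹ • ∑ j, hess (f (S j)) x

/-- A batch may be drawn with or without replacement. -/
inductive Sampling where
  | withReplacement
  | withoutReplacement

/-- The equally likely batches of size `s` (listed in the order in which they are drawn). -/
def Sampling.batches (T : Sampling) (s m : ℕ) : Set (Fin s → Fin m) :=
  match T with
  | .withReplacement => Set.univ
  | .withoutReplacement => {S | Function.Injective S}

/-! ### The conjugate gradient method -/

/-- The current point, residual `A d + g` and search direction. -/
structure CGState (n : ℕ) where
  d : Vec n
  r : Vec n
  p : Vec n

/-- One step of the conjugate gradient method for a system with operator `A`. -/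
def cgStep {n : ℕ} (A : Op n) (c : CGState n) : CGState n :=
  let a : ℝ := ‖c.r‖ ^ 2 / ⟪c.p, A c.p⟫
  let r' : Vec n := c.r + a • A c.p
  { d := c.d + a • c.p
    r := r'
    p := -r' + (‖r'‖ ^ 2 / ‖c.r‖ ^ 2) • c.p }

/-- The `j`-th iterate of the conjugate gradient method for `A d = -g`, started at `0`. -/
def cgIterate {n : ℕ} (A : Op n) (g : Vec n) (j : ℕ) : Vec n :=
  ((cgStep A)^[j] { d := 0, r := g, p := -g }).d

/-! ### The regularized Newton and negative curvature method -/

/-- `Iteration Lh εg εh μ η x g Q p d X'` says that one iteration at the point `x`, with approximate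
gradient `g`, approximate Hessian `Q` and approximate eigenvector `p` of `Q`, with
`⟪p, Q p⟫` as approximate smallest eigenvalue, may use the direction `d` and have the outcome `X'`:
`Sum.inl x'` means that the method goes on with the next iterate `x'`, and `Sum.inr y` that it
terminates and returns `y`. -/
inductive Iteration {n : ℕ} (Lh εg εh μ η : ℝ) (x g : Vec n) (Q : Op n) (p : Vec n) :
    Vec n → Vec n ⊕ Vec n → Prop
  /-- Negative curvature step, in either phase, along `-sign ⟪g, p⟫ • p`. The sign `σ` is always
  `1` or `-1`; if `⟪g, p⟫ = 0` it may be either. -/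
  | nc (σ : ℝ) (hcurv : ⟪p, Q p⟫ < -εh) (hσ : σ = 1 ∨ σ = -1) (hsign : σ * ⟪g, p⟫ = |⟪g, p⟫|) :
      Iteration Lh εg εh μ η x g Q p
        (-(σ • p)) (Sum.inl (x + (17 / (12 * Lh) * εh) • (-(σ • p))))
  /-- First phase, approximate Newton step. -/
  | sol (j : ℕ) (d : Vec n) (hg : εg ≤ ‖g‖) (hcurv : -εh ≤ ⟪p, Q p⟫)
      (hd : d = cgIterate (Q + (2 * εh) • ContinuousLinearMap.id ℝ (Vec n)) g j)
      (hres : ‖(Q + (2 * εh) • ContinuousLinearMap.id ℝ (Vec n)) d + g‖ ≤ μ * εh * ‖d‖)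
      (hlong : 2 * εg / εh < ‖d‖) :
      Iteration Lh εg εh μ η x g Q p
        d (Sum.inl (x + (√2 / (√(3 * (Lh + η)) * ‖d‖) * √εg) • d))
  /-- First phase, termination after a short approximate Newton direction. -/
  | stopSol (j : ℕ) (d : Vec n) (hg : εg ≤ ‖g‖) (hcurv : -εh ≤ ⟪p, Q p⟫)
      (hd : d = cgIterate (Q + (2 * εh) • ContinuousLinearMap.id ℝ (Vec n)) g j)
      (hres : ‖(Q + (2 * εh) • ContinuousLinearMap.id ℝ (Vec n)) d + g‖ ≤ μ * εh * ‖d‖)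
      (hshort : ‖d‖ ≤ 2 * εg / εh) :
      Iteration Lh εg εh μ η x g Q p d (Sum.inr (x + d))
  /-- Second phase, termination at the current point (no direction is computed: `d = 0`). -/
  | stopSmall (hg : ‖g‖ < εg) (hcurv : -εh ≤ ⟪p, Q p⟫) :
      Iteration Lh εg εh μ η x g Q p 0 (Sum.inr x)

/-- A random run of the method on the finite sum of the `f i`, with derivatives subsampled in fresh
independent uniform batches. `X k ω = Sum.inl x` means that iteration `k` is reached with iterate
`x`, and `X k ω = Sum.inr y` that the method has returned `y` in one of the iterations before `k`.
The eigenvectors `p` and the rest of the process may use further randomness, but the batches of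
iteration `k` are independent of the past `ℱ k`. -/
structure SubsampledRun {n m : ℕ} (f : Fin m → Vec n → ℝ) (x₀ : Vec n) (Lh εg εh μ η : ℝ)
    (T : Sampling) (sg sh : ℕ → ℕ) {Ω : Type*} {mΩ : MeasurableSpace Ω} (P : Measure Ω) where
  ℱ : Filtration ℕ mΩ
  X : ℕ → Ω → Vec n ⊕ Vec n
  Sg : (k : ℕ) → Ω → (Fin (sg k) → Fin m)
  Sh : (k : ℕ) → Ω → (Fin (sh k) → Fin m)
  p : ℕ → Ω → Vec n
  d : ℕ → Ω → Vec n
  measurable_X : ∀ k, Measurable[ℱ k] (X k)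
  measurable_Sg : ∀ k, Measurable[ℱ (k + 1)] (Sg k)
  measurable_Sh : ∀ k, Measurable[ℱ (k + 1)] (Sh k)
  indep_past : ∀ k,
    Indep (ℱ k) (MeasurableSpace.comap (fun ω => (Sg k ω, Sh k ω)) inferInstance) P
  indep_batches : ∀ k, IndepFun (Sg k) (Sh k) P
  law_Sg : ∀ k, P.map (Sg k) = uniformOn (T.batches (sg k) m)
  law_Sh : ∀ k, P.map (Sh k) = uniformOn (T.batches (sh k) m)
  start : ∀ ω, X 0 ω = Sum.inl x₀
  step : ∀ k ω x, X k ω = Sum.inl x →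
    Iteration Lh εg εh μ η x (subGrad f (Sg k ω) x) (subHess f (Sh k ω) x) (p k ω) (d k ω)
      (X (k + 1) ω)
  stay : ∀ k ω y, X k ω = Sum.inr y → X (k + 1) ω = Sum.inr y

/-- The accuracy required of the approximate eigenvectors, in every iteration that is reached:
`p` is a unit vector whose Rayleigh quotient is within `εh / 2` of the smallest eigenvalue of the
approximate Hessian. -/
def SubsampledRun.EigAccurate {n m : ℕ} {f : Fin m → Vec n → ℝ} {x₀ : Vec n} {Lh εg εh μ η : ℝ}
    {T : Sampling} {sg sh : ℕ → ℕ} {Ω : Type*} {mΩ : MeasurableSpace Ω} {P : Measure Ω}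
    (R : SubsampledRun f x₀ Lh εg εh μ η T sg sh P) : Prop :=
  ∀ k ω x, R.X k ω = Sum.inl x →
    ‖R.p k ω‖ = 1 ∧
      ⟪R.p k ω, subHess f (R.Sh k ω) x (R.p k ω)⟫ - lamMin (subHess f (R.Sh k ω) x) ≤ εh / 2

/-- `B` contains the segments `[x_k, x_k + d_k]` and `[x_k, x_{k+1}]` of all iterations that are
reached (the second one is part of the first whenever the step size is at most `1`). -/
def SubsampledRun.StaysIn {n m : ℕ} {f : Fin m → Vec n → ℝ} {x₀ : Vec n} {Lh εg εh μ η : ℝ}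
    {T : Sampling} {sg sh : ℕ → ℕ} {Ω : Type*} {mΩ : MeasurableSpace Ω} {P : Measure Ω}
    (R : SubsampledRun f x₀ Lh εg εh μ η T sg sh P) (B : Set (Vec n)) : Prop :=
  ∀ k ω x, R.X k ω = Sum.inl x →
    segment ℝ x (x + R.d k ω) ⊆ B ∧ ∀ x', R.X (k + 1) ω = Sum.inl x' → segment ℝ x x' ⊆ B

/-- Guaranteed decrease constant of a negative curvature step. -/
def cNC (Lh : ℝ) : ℝ := 17 / (10368 * √Lh)

/-- Guaranteed decrease constant of an approximate Newton step. -/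
def cSOL (Lh η : ℝ) : ℝ := √2 * η / (9 * √3 * (Lh + η) ^ (3 / 2 : ℝ))

/-- The iteration bound, for an initial gap `Δ = f x₀ - f_*`. -/
def iterBound (Lh η Δ ε : ℝ) : ℕ :=
  ⌈2 * Δ / min (cNC Lh) (cSOL Lh η) * ε ^ (-(3 / 2) : ℝ)⌉₊ + 1

end

/-! The argument separates a deterministic descent estimate from a probabilistic statement about
fresh batches.

Descent. Suppose the sampled gradient is within `ε / 3` and the sampled Hessian within `√(L * ε) /
18` of the true ones. The cubic Taylor model then shows that every step that continues lowers the
objective by a fixed multiple of `ε ^ (3 / 2)` (`decrease_negativeCurvature`, `decrease_newton`).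
The Newton case rests on `inner_cgIterate_residual`: a conjugate gradient residual is orthogonal to
its iterate, so `⟪g, d⟫ = -⟪d, A d⟫`. A step that stops returns a good point
(`Iteration.decrease_or_stationary`). The objective is bounded below, so `iterBound` steps cannot
all be decreasing (`lt_iterBound_mul`).

Sampling. At a fixed point of `B` in the level set, fresh batches are accurate with probability at
least `1 - δ` (`le_map_accurateBatches`). Exponential moments are convex functions of the batch sum,
and Hoeffding's comparison reduces drawing without replacement to independent draws. For gradients,
McDiarmid's bound is applied to the norm of the centred sum. For Hessians, the moment is the trace
of `cosh (θ M)`: exchanging one draw for a fresh copy bounds its derivative in `θ` by a multiple of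
itself, and integrating gives `sum_coshTrace_le`. Noncommutativity is handled by expanding traces
over pairs of eigenvectors of the two operators.

Combination. The batches are independent of the past, which determines the iterate, so the
probabilities multiply (`exists_measurableSet_forall_lt`). Accuracy is likely only at points of the
level set. This suffices, since on the good event the decrease keeps the run in that set. -/

/-! ### Symmetric operators -/

section Symmetric

variable {n : ℕ}

/-- Symmetry of an operator on `ℝⁿ`. -/
def SymmOp (A : Op n) : Prop := ∀ u v : Vec n, ⟪A u, v⟫ = ⟪u, A v⟫

theorem SymmOp.isSymmetric {A : Op n} (hA : SymmOp A) : (A : Vec n →ₗ[ℝ] Vec n).IsSymmetric :=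
  fun u v => hA u v

theorem SymmOp.add {A B : Op n} (hA : SymmOp A) (hB : SymmOp B) : SymmOp (A + B) := fun u v => by
  simp [inner_add_left, inner_add_right, hA u v, hB u v]

theorem SymmOp.sub {A B : Op n} (hA : SymmOp A) (hB : SymmOp B) : SymmOp (A - B) := fun u v => by
  simp [inner_sub_left, inner_sub_right, hA u v, hB u v]

theorem SymmOp.smul {A : Op n} (hA : SymmOp A) (c : ℝ) : SymmOp (c • A) := fun u v => by
  simp [inner_smul_left, inner_smul_right, hA u v]

theorem SymmOp.id : SymmOp (ContinuousLinearMap.id ℝ (Vec n)) := fun _ _ => rfl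

theorem SymmOp.sum {ι : Type*} (s : Finset ι) {A : ι → Op n} (hA : ∀ i ∈ s, SymmOp (A i)) :
    SymmOp (∑ i ∈ s, A i) := fun u v => by
  simp only [sum_apply, sum_inner, inner_sum]
  exact Finset.sum_congr rfl fun i hi => hA i hi u v

open Classical in
/-- An orthonormal basis, made of eigenvectors when `A` is symmetric. -/
noncomputable def eigBasis (A : Op n) : OrthonormalBasis (Fin n) ℝ (Vec n) :=
  if h : (A : Vec n →ₗ[ℝ] Vec n).IsSymmetric then h.eigenvectorBasis (by simp)
  else EuclideanSpace.basisFun (Fin n) ℝ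

/-- The Rayleigh quotients of `A` on `eigBasis A`: its eigenvalues when `A` is symmetric. -/
noncomputable def eigVal (A : Op n) (i : Fin n) : ℝ := ⟪eigBasis A i, A (eigBasis A i)⟫

theorem SymmOp.apply_eigBasis {A : Op n} (hA : SymmOp A) (i : Fin n) :
    A (eigBasis A i) = eigVal A i • eigBasis A i := by
  have hs := hA.isSymmetric
  have h1 : eigBasis A = hs.eigenvectorBasis (by simp) := by simp [eigBasis, hs]
  have h2 := hs.apply_eigenvectorBasis (by simp) i
  rw [← h1] at h2
  simp only [ContinuousLinearMap.coe_coe] at h2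
  have h3 : eigVal A i = hs.eigenvalues (by simp) i := by
    rw [eigVal, h2, inner_smul_right, real_inner_self_eq_norm_sq]
    simp
  rw [h3]
  exact h2

theorem sum_inner_mul_inner_basis (b : OrthonormalBasis (Fin n) ℝ (Vec n)) (x y : Vec n) :
    ∑ i, ⟪b i, x⟫ * ⟪b i, y⟫ = ⟪x, y⟫ := by
  rw [← b.sum_inner_mul_inner x y]
  exact Finset.sum_congr rfl fun i _ => by rw [real_inner_comm]

theorem sum_inner_sq_basis (b : OrthonormalBasis (Fin n) ℝ (Vec n)) (x : Vec n) :
    ∑ i, ⟪b i, x⟫ ^ 2 = ‖x‖ ^ 2 := by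
  rw [← real_inner_self_eq_norm_sq, ← sum_inner_mul_inner_basis b]
  exact Finset.sum_congr rfl fun i _ => by ring

theorem SymmOp.inner_eigBasis_apply {A : Op n} (hA : SymmOp A) (i : Fin n) (x : Vec n) :
    ⟪eigBasis A i, A x⟫ = eigVal A i * ⟪eigBasis A i, x⟫ := by
  rw [← hA, hA.apply_eigBasis, real_inner_smul_left]

theorem SymmOp.inner_apply_eq_sum {A : Op n} (hA : SymmOp A) (x : Vec n) :
    ⟪x, A x⟫ = ∑ i, eigVal A i * ⟪eigBasis A i, x⟫ ^ 2 := by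
  rw [← sum_inner_mul_inner_basis (eigBasis A)]
  exact Finset.sum_congr rfl fun i _ => by rw [hA.inner_eigBasis_apply]; ring

theorem SymmOp.norm_apply_sq_eq_sum {A : Op n} (hA : SymmOp A) (x : Vec n) :
    ‖A x‖ ^ 2 = ∑ i, eigVal A i ^ 2 * ⟪eigBasis A i, x⟫ ^ 2 := by
  rw [← sum_inner_sq_basis (eigBasis A)]
  exact Finset.sum_congr rfl fun i _ => by rw [hA.inner_eigBasis_apply]; ring

/-! ### The smallest eigenvalue -/

theorem SymmOp.hasEigenvalue_eigVal {A : Op n} (hA : SymmOp A) (i : Fin n) :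
    Module.End.HasEigenvalue (A : Vec n →ₗ[ℝ] Vec n) (eigVal A i) := by
  refine Module.End.hasEigenvalue_of_hasEigenvector (x := eigBasis A i) ⟨?_, ?_⟩
  · rw [Module.End.mem_eigenspace_iff]
    exact hA.apply_eigBasis i
  · intro h
    have := (eigBasis A).norm_eq_one i
    simp [h] at this

theorem bddBelow_eigenvalues (A : Op n) :
    BddBelow {l : ℝ | Module.End.HasEigenvalue (A : Vec n →ₗ[ℝ] Vec n) l} := by
  refine ⟨-‖A‖, fun l hl => ?_⟩
  obtain ⟨v, hv⟩ := hl.exists_hasEigenvector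
  have h1 : A v = l • v := hv.apply_eq_smul
  have h2 := A.le_opNorm v
  rw [h1, norm_smul] at h2
  have h3 : |l| ≤ ‖A‖ := le_of_mul_le_mul_right h2 (norm_pos_iff.2 hv.2)
  exact (abs_le.1 h3).1

theorem SymmOp.lamMin_mul_le {A : Op n} (hA : SymmOp A) (x : Vec n) :
    lamMin A * ‖x‖ ^ 2 ≤ ⟪x, A x⟫ := by
  rw [hA.inner_apply_eq_sum, ← sum_inner_sq_basis (eigBasis A), Finset.mul_sum]
  exact Finset.sum_le_sum fun i _ => mul_le_mul_of_nonneg_right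
    (csInf_le (bddBelow_eigenvalues A) (hA.hasEigenvalue_eigVal i)) (sq_nonneg _)

theorem SymmOp.le_lamMin {A : Op n} (hA : SymmOp A) (hn : 0 < n) {c : ℝ}
    (h : ∀ x : Vec n, c * ‖x‖ ^ 2 ≤ ⟪x, A x⟫) : c ≤ lamMin A := by
  -- Positive dimension makes the set of eigenvalues nonempty; its infimum would otherwise be the
  -- default value `0`.
  refine le_csInf ⟨_, hA.hasEigenvalue_eigVal ⟨0, hn⟩⟩ fun l hl => ?_
  obtain ⟨v, hv⟩ := hl.exists_hasEigenvector
  have h1 : A v = l • v := hv.apply_eq_smul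
  have h2 := h v
  rw [h1, inner_smul_right, real_inner_self_eq_norm_sq] at h2
  exact le_of_mul_le_mul_right h2 (pow_pos (norm_pos_iff.2 hv.2) 2)

/-! ### The trace of the hyperbolic cosine -/

/-- The trace of `cosh (θ A)` for a symmetric operator `A`. -/
noncomputable def coshTrace (θ : ℝ) (A : Op n) : ℝ := ∑ i, Real.cosh (θ * eigVal A i)

/-- The trace of `sinh (θ A) Y` for a symmetric operator `A`. -/
noncomputable def sinhTrace (θ : ℝ) (A Y : Op n) : ℝ :=
  ∑ i, Real.sinh (θ * eigVal A i) * ⟪eigBasis A i, Y (eigBasis A i)⟫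

theorem coshTrace_nonneg (θ : ℝ) (A : Op n) : 0 ≤ coshTrace θ A :=
  Finset.sum_nonneg fun _ _ => (Real.cosh_pos _).le

theorem coshTrace_zero (A : Op n) : coshTrace 0 A = n := by simp [coshTrace]

theorem hasDerivAt_coshTrace (A : Op n) (θ : ℝ) :
    HasDerivAt (fun t => coshTrace t A) (sinhTrace θ A A) θ := by
  unfold coshTrace sinhTrace
  refine HasDerivAt.fun_sum fun i _ => ?_
  simpa [eigVal] using ((hasDerivAt_id θ).mul_const (eigVal A i)).cosh

theorem sinhTrace_sum {ι : Type*} (s : Finset ι) (θ : ℝ) (A : Op n) (Y : ι → Op n) :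
    sinhTrace θ A (∑ j ∈ s, Y j) = ∑ j ∈ s, sinhTrace θ A (Y j) := by
  simp only [sinhTrace, sum_apply, inner_sum, Finset.mul_sum]
  exact Finset.sum_comm

/-- The function `t * cosh t - sinh t` vanishes at `0` and has derivative `t * sinh t ≥ 0` on the
half-line; evenness covers negative `y`. -/
theorem mul_sinh_le_sq_mul_cosh (y : ℝ) : y * Real.sinh y ≤ y ^ 2 * Real.cosh y := by
  have key : ∀ z : ℝ, 0 ≤ z → Real.sinh z ≤ z * Real.cosh z := by
    intro z hz
    have hm : MonotoneOn (fun t => t * Real.cosh t - Real.sinh t) (Set.Ici 0) := by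
      refine monotoneOn_of_deriv_nonneg (convex_Ici 0) (by fun_prop) (by fun_prop) fun t ht => ?_
      have hd : HasDerivAt (fun t => t * Real.cosh t - Real.sinh t)
          (1 * Real.cosh t + t * Real.sinh t - Real.cosh t) t :=
        ((hasDerivAt_id t).mul (Real.hasDerivAt_cosh t)).sub (Real.hasDerivAt_sinh t)
      rw [hd.deriv]
      simp only [interior_Ici, Set.mem_Ioi] at ht
      have := mul_nonneg ht.le (Real.sinh_nonneg_iff.2 ht.le)
      linarith
    have := hm (Set.mem_Ici.2 le_rfl) (Set.mem_Ici.2 hz) hz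
    simp at this
    linarith
  rcases le_total 0 y with hy | hy
  · have := mul_le_mul_of_nonneg_left (key y hy) hy
    nlinarith
  · have := mul_le_mul_of_nonneg_left (key (-y) (by linarith)) (neg_nonneg.2 hy)
    simp only [Real.sinh_neg, Real.cosh_neg] at this
    nlinarith

/-- In the half-sum `x` and half-difference `y`, the addition formulas leave the previous inequality
in `y` multiplied by `4 * cosh x`. -/
theorem sub_mul_sinh_sub_sinh_le (a b : ℝ) :
    (a - b) * (Real.sinh a - Real.sinh b) ≤ (a - b) ^ 2 / 2 * (Real.cosh a + Real.cosh b) := by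
  obtain ⟨x, y, rfl, rfl⟩ : ∃ x y : ℝ, a = x + y ∧ b = x - y :=
    ⟨(a + b) / 2, (a - b) / 2, by ring, by ring⟩
  rw [Real.sinh_add, Real.sinh_sub, Real.cosh_add, Real.cosh_sub]
  have := mul_le_mul_of_nonneg_left (mul_sinh_le_sq_mul_cosh y) (Real.cosh_pos x).le
  nlinarith

/-- The squared inner products of two orthonormal bases are doubly stochastic weights. They turn a
trace of noncommuting operators into a scalar sum over pairs of eigenvalues. -/
theorem SymmOp.sinhTrace_sub_eq (W : Op n) {Z : Op n} (hZ : SymmOp Z) (θ : ℝ) :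
    sinhTrace θ W (W - Z) = ∑ i, ∑ j, ⟪eigBasis W i, eigBasis Z j⟫ ^ 2 *
      (Real.sinh (θ * eigVal W i) * (eigVal W i - eigVal Z j)) := by
  refine Finset.sum_congr rfl fun i _ => ?_
  have h1 : ∑ j, ⟪eigBasis W i, eigBasis Z j⟫ ^ 2 = 1 := by
    have := sum_inner_sq_basis (eigBasis Z) (eigBasis W i)
    simp only [OrthonormalBasis.norm_eq_one, one_pow] at this
    rw [← this]
    exact Finset.sum_congr rfl fun j _ => by rw [real_inner_comm]
  have h2 : ⟪eigBasis W i, Z (eigBasis W i)⟫ =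
      ∑ j, ⟪eigBasis W i, eigBasis Z j⟫ ^ 2 * eigVal Z j := by
    rw [hZ.inner_apply_eq_sum]
    exact Finset.sum_congr rfl fun j _ => by rw [real_inner_comm, mul_comm]
  have h3 : ⟪eigBasis W i, (W - Z) (eigBasis W i)⟫ =
      ∑ j, ⟪eigBasis W i, eigBasis Z j⟫ ^ 2 * (eigVal W i - eigVal Z j) := by
    rw [sub_apply, inner_sub_right, h2]
    simp only [mul_sub, Finset.sum_sub_distrib, ← Finset.sum_mul, h1, one_mul]
    rfl
  rw [h3, Finset.mul_sum]
  exact Finset.sum_congr rfl fun j _ => by ring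

/-- For fixed `i`, the weighted sum of squared eigenvalue gaps over `j` is `‖(W - Z) w‖ ^ 2` at the
unit eigenvector `w = eigBasis W i`. -/
theorem SymmOp.sum_cosh_mul_sq_le {W Z : Op n} (hW : SymmOp W) (hZ : SymmOp Z) (θ : ℝ) {D : ℝ}
    (hD : ‖W - Z‖ ≤ D) :
    ∑ i, ∑ j, ⟪eigBasis W i, eigBasis Z j⟫ ^ 2 *
      (Real.cosh (θ * eigVal W i) * (eigVal W i - eigVal Z j) ^ 2) ≤ D ^ 2 * coshTrace θ W := by
  rw [coshTrace, Finset.mul_sum]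
  refine Finset.sum_le_sum fun i _ => ?_
  have h1 : ∑ j, ⟪eigBasis W i, eigBasis Z j⟫ ^ 2 * (eigVal W i - eigVal Z j) ^ 2 ≤ D ^ 2 := by
    have h2 : ∀ j, ⟪eigBasis W i, eigBasis Z j⟫ ^ 2 * (eigVal W i - eigVal Z j) ^ 2 =
        ⟪eigBasis Z j, (W - Z) (eigBasis W i)⟫ ^ 2 := fun j => by
      rw [sub_apply, inner_sub_right, hZ.inner_eigBasis_apply,
        hW.apply_eigBasis, real_inner_smul_right, real_inner_comm]
      ring
    simp only [h2]
    rw [sum_inner_sq_basis]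
    have h3 := (W - Z).le_opNorm (eigBasis W i)
    rw [OrthonormalBasis.norm_eq_one, mul_one] at h3
    exact pow_le_pow_left₀ (norm_nonneg _) (h3.trans hD) 2
  calc _ = Real.cosh (θ * eigVal W i) *
        ∑ j, ⟪eigBasis W i, eigBasis Z j⟫ ^ 2 * (eigVal W i - eigVal Z j) ^ 2 := by
        rw [Finset.mul_sum]
        exact Finset.sum_congr rfl fun j _ => by ring
    _ ≤ Real.cosh (θ * eigVal W i) * D ^ 2 :=
        mul_le_mul_of_nonneg_left h1 (Real.cosh_pos _).le
    _ = _ := mul_comm _ _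

/-- The exchange inequality behind the trace bounds. -/
theorem SymmOp.sinhTrace_exchange_le {W Z : Op n} (hW : SymmOp W) (hZ : SymmOp Z) {θ D : ℝ}
    (hθ : 0 ≤ θ) (hD : ‖W - Z‖ ≤ D) :
    sinhTrace θ W (W - Z) + sinhTrace θ Z (Z - W) ≤
      θ / 2 * D ^ 2 * (coshTrace θ W + coshTrace θ Z) := by
  have hD' : ‖Z - W‖ ≤ D := by rwa [norm_sub_rev]
  have h1 := hW.sum_cosh_mul_sq_le hZ θ hD
  have h2 := hZ.sum_cosh_mul_sq_le hW θ hD'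
  rw [Finset.sum_comm] at h2
  rw [SymmOp.sinhTrace_sub_eq W hZ, SymmOp.sinhTrace_sub_eq Z hW, Finset.sum_comm (γ := Fin n)
    (f := fun i j => ⟪eigBasis Z i, eigBasis W j⟫ ^ 2 * _)]
  have h3 := mul_le_mul_of_nonneg_left (add_le_add h1 h2) (div_nonneg hθ zero_le_two)
  refine le_trans ?_ (h3.trans_eq (by ring))
  simp only [← Finset.sum_add_distrib, Finset.mul_sum]
  refine Finset.sum_le_sum fun i _ => Finset.sum_le_sum fun j _ => ?_
  rw [real_inner_comm (eigBasis W i) (eigBasis Z j)]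
  rcases hθ.eq_or_lt with rfl | hpos
  · simp
  -- Both traces now run over the same pairs with the same weights, so one scalar inequality per
  -- pair suffices. It carries an extra factor `θ` to be cancelled, hence the separate case `θ = 0`.
  have h4 := sub_mul_sinh_sub_sinh_le (θ * eigVal W i) (θ * eigVal Z j)
  have h5 : (eigVal W i - eigVal Z j) *
      (Real.sinh (θ * eigVal W i) - Real.sinh (θ * eigVal Z j)) ≤
      θ / 2 * (eigVal W i - eigVal Z j) ^ 2 *
      (Real.cosh (θ * eigVal W i) + Real.cosh (θ * eigVal Z j)) := by
    refine le_of_mul_le_mul_left ?_ hpos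
    calc _ = (θ * eigVal W i - θ * eigVal Z j) *
        (Real.sinh (θ * eigVal W i) - Real.sinh (θ * eigVal Z j)) := by ring
      _ ≤ _ := h4
      _ = _ := by ring
  have h6 := mul_le_mul_of_nonneg_left h5 (sq_nonneg ⟪eigBasis W i, eigBasis Z j⟫)
  calc _ = ⟪eigBasis W i, eigBasis Z j⟫ ^ 2 * ((eigVal W i - eigVal Z j) *
      (Real.sinh (θ * eigVal W i) - Real.sinh (θ * eigVal Z j))) := by ring
    _ ≤ _ := h6
    _ = _ := by ring

theorem convexOn_cosh_mul (θ : ℝ) : ConvexOn ℝ Set.univ fun x => Real.cosh (θ * x) := by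
  have h1 : ConvexOn ℝ Set.univ fun x : ℝ => Real.exp (θ * x) :=
    convexOn_exp.comp_linearMap (LinearMap.mul ℝ ℝ θ)
  have h2 : ConvexOn ℝ Set.univ fun x : ℝ => Real.exp (-θ * x) :=
    convexOn_exp.comp_linearMap (LinearMap.mul ℝ ℝ (-θ))
  have h3 := (h1.add h2).smul (c := (1 / 2 : ℝ)) (by norm_num)
  refine h3.congr fun x _ => ?_
  simp only [Pi.add_apply, smul_eq_mul, neg_mul, Real.cosh_eq]
  ring

/-- Peierls' inequality. -/
theorem SymmOp.sum_cosh_inner_le {A : Op n} (hA : SymmOp A) (θ : ℝ)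
    (b : OrthonormalBasis (Fin n) ℝ (Vec n)) :
    ∑ i, Real.cosh (θ * ⟪b i, A (b i)⟫) ≤ coshTrace θ A := by
  have h1 : ∀ i, Real.cosh (θ * ⟪b i, A (b i)⟫) ≤
      ∑ j, ⟪eigBasis A j, b i⟫ ^ 2 * Real.cosh (θ * eigVal A j) := fun i => by
    -- Jensen: a Rayleigh quotient is the average of the eigenvalues with these weights.
    have := (convexOn_cosh_mul θ).map_sum_le (t := Finset.univ)
      (w := fun j => ⟪eigBasis A j, b i⟫ ^ 2) (p := eigVal A) (fun _ _ => sq_nonneg _)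
      (by rw [sum_inner_sq_basis, OrthonormalBasis.norm_eq_one, one_pow]) (by simp)
    rw [hA.inner_apply_eq_sum]
    simpa [mul_comm] using this
  refine (Finset.sum_le_sum fun i _ => h1 i).trans_eq ?_
  rw [Finset.sum_comm, coshTrace]
  refine Finset.sum_congr rfl fun j _ => ?_
  rw [← Finset.sum_mul]
  have := sum_inner_sq_basis b (eigBasis A j)
  simp only [OrthonormalBasis.norm_eq_one, one_pow] at this
  rw [Finset.sum_congr rfl fun i _ => by rw [real_inner_comm], this, one_mul]

/-- In the eigenbasis of the combination, its eigenvalues are the combinations of Rayleigh quotients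
of `A` and `B`. Scalar convexity followed by Peierls' inequality concludes. Convexity is what
Hoeffding's comparison needs. -/
theorem convexOn_coshTrace (θ : ℝ) : ConvexOn ℝ {A : Op n | SymmOp A} (coshTrace θ) := by
  refine ⟨fun A hA B hB a b _ _ _ => (SymmOp.smul hA a).add (SymmOp.smul hB b),
    fun A hA B hB a b ha hb hab => ?_⟩
  set W := a • A + b • B with hW
  have h1 : ∀ i, Real.cosh (θ * eigVal W i) ≤
      a * Real.cosh (θ * ⟪eigBasis W i, A (eigBasis W i)⟫) +
      b * Real.cosh (θ * ⟪eigBasis W i, B (eigBasis W i)⟫) := fun i => by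
    have := (convexOn_cosh_mul θ).2 (Set.mem_univ ⟪eigBasis W i, A (eigBasis W i)⟫)
      (Set.mem_univ ⟪eigBasis W i, B (eigBasis W i)⟫) ha hb hab
    have h2 : eigVal W i = a • ⟪eigBasis W i, A (eigBasis W i)⟫ +
        b • ⟪eigBasis W i, B (eigBasis W i)⟫ := by
      have h3 : ∀ x, W x = a • A x + b • B x := fun x => by simp [hW]
      rw [eigVal, h3, inner_add_right, inner_smul_right, inner_smul_right]
      rfl
    rw [h2]
    exact this
  calc coshTrace θ W ≤ _ := Finset.sum_le_sum fun i _ => h1 i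
    _ = a * ∑ i, Real.cosh (θ * ⟪eigBasis W i, A (eigBasis W i)⟫) +
        b * ∑ i, Real.cosh (θ * ⟪eigBasis W i, B (eigBasis W i)⟫) := by
        rw [Finset.sum_add_distrib, Finset.mul_sum, Finset.mul_sum]
    _ ≤ _ := add_le_add (mul_le_mul_of_nonneg_left (SymmOp.sum_cosh_inner_le hA θ _) ha)
        (mul_le_mul_of_nonneg_left (SymmOp.sum_cosh_inner_le hB θ _) hb)

theorem SymmOp.norm_le_of_abs_eigVal_le {A : Op n} (hA : SymmOp A) {t : ℝ} (ht : 0 ≤ t)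
    (h : ∀ i, |eigVal A i| ≤ t) : ‖A‖ ≤ t := by
  refine A.opNorm_le_bound ht fun x => ?_
  refine le_of_sq_le_sq ?_ (mul_nonneg ht (norm_nonneg _))
  rw [hA.norm_apply_sq_eq_sum, mul_pow, ← sum_inner_sq_basis (eigBasis A), Finset.mul_sum]
  refine Finset.sum_le_sum fun i _ => mul_le_mul_of_nonneg_right ?_ (sq_nonneg _)
  rw [← sq_abs]
  exact pow_le_pow_left₀ (abs_nonneg _) (h i) 2

/-- Since `cosh` is even, one trace detects a large eigenvalue of either sign; the price is the
factor `1 / 2`. -/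
theorem SymmOp.exp_le_coshTrace {A : Op n} (hA : SymmOp A) (θ : ℝ) {t : ℝ} (ht : 0 ≤ t)
    (h : t < ‖A‖) : Real.exp (θ * t) / 2 ≤ coshTrace θ A := by
  obtain ⟨i, hi⟩ : ∃ i, t < |eigVal A i| := by
    by_contra! hcon
    exact absurd (hA.norm_le_of_abs_eigVal_le ht hcon) (not_le.2 h)
  calc Real.exp (θ * t) / 2 ≤ Real.cosh (θ * t) := by
        rw [Real.cosh_eq]
        have := Real.exp_pos (-(θ * t))
        linarith
    _ ≤ Real.cosh (θ * eigVal A i) := by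
        rw [Real.cosh_le_cosh, abs_mul, abs_mul, abs_of_nonneg ht]
        exact mul_le_mul_of_nonneg_left hi.le (abs_nonneg _)
    _ ≤ _ := Finset.single_le_sum (f := fun i => Real.cosh (θ * eigVal A i))
        (fun _ _ => (Real.cosh_pos _).le) (Finset.mem_univ i)

end Symmetric

/-! ### Sums over batches -/

section Batches

theorem sum_fin_succ_fun {α M : Type*} [Fintype α] [AddCommMonoid M] {s : ℕ}
    (F : (Fin (s + 1) → α) → M) :
    ∑ S, F S = ∑ a, ∑ S : Fin s → α, F (Fin.cons a S) := by
  rw [← Fintype.sum_prod_type']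
  exact ((Fin.consEquiv fun _ => α).sum_comp F).symm

theorem sum_sub_sum_update {ι α V : Type*} [Fintype ι] [DecidableEq ι] [AddCommGroup V]
    (X : α → V) (S : ι → α) (i : ι) (c : α) :
    ∑ j, X (S j) - ∑ j, X (Function.update S i c j) = X (S i) - X c := by
  rw [← Finset.sum_sub_distrib, Finset.sum_eq_single i]
  · simp
  · intro j _ hj
    simp [hj]
  · simp

/-- Swapping the `i`-th draw with a fresh draw `c` is an involution of the pairs `(S, c)`: the two
batches form an exchangeable pair. -/
theorem sum_sum_update {ι α : Type*} [Fintype ι] [DecidableEq ι] [Fintype α]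
    (i : ι) (F : (ι → α) → α → ℝ) :
    ∑ S, ∑ c, F (Function.update S i c) (S i) = ∑ S, ∑ c, F S c := by
  rw [← Fintype.sum_prod_type', ← Fintype.sum_prod_type']
  let e : (ι → α) × α → (ι → α) × α := fun q => (Function.update q.1 i q.2, q.1 i)
  have hinv : Function.Involutive e := fun q => by simp [e]
  exact Equiv.sum_comp hinv.toPerm fun q => F q.1 q.2

/-- The symmetric group acts transitively on injective `s`-tuples, so reindexing by a permutation
carries one to the other. -/
theorem sum_perm_comp_embedding {α : Type*} [Fintype α] [DecidableEq α] {s : ℕ}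
    (F : (Fin s → α) → ℝ) (J J' : Fin s ↪ α) :
    ∑ π : Equiv.Perm α, F (π ∘ J) = ∑ π : Equiv.Perm α, F (π ∘ J') := by
  have := Equiv.Perm.isMultiplyPretransitive α s
  obtain ⟨g, rfl⟩ := MulAction.exists_smul_eq (Equiv.Perm α) J J'
  rw [← Equiv.sum_comp (Equiv.mulRight g) fun π : Equiv.Perm α => F (π ∘ J)]
  rfl

/-- The image of `Z` is enlarged to exactly `s` indices, which `J` enumerates. A batch with
repetitions thus becomes a repeated selection from one without. -/
theorem exists_embedding_factor {m s : ℕ} (h : s ≤ m) (Z : Fin s → Fin m) :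
    ∃ (J : Fin s ↪ Fin m) (t : Fin s → Fin s), Z = J ∘ t := by
  classical
  obtain ⟨R, hR, hcard⟩ := Finset.exists_superset_card_eq (s := Finset.univ.image Z) (n := s)
    (Finset.card_image_le.trans (by simp)) (by simpa using h)
  refine ⟨(R.orderEmbOfFin hcard).toEmbedding,
    fun i => (R.orderIsoOfFin hcard).symm ⟨Z i, hR (by simp)⟩, ?_⟩
  ext i
  simp [Finset.orderEmbOfFin]

theorem sum_perm_apply {s : ℕ} {V : Type*} [AddCommMonoid V] [Module ℝ V] (x : Fin s → V)
    (i : Fin s) :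
    ∑ σ : Equiv.Perm (Fin s), (Fintype.card (Equiv.Perm (Fin s)) : ℝ)⁻¹ • x (σ i) =
      (s : ℝ)⁻¹ • ∑ j, x j := by
  have h1 : ∀ j, ∑ σ : Equiv.Perm (Fin s), x (σ i) = ∑ σ : Equiv.Perm (Fin s), x (σ j) := by
    intro j
    rw [← Equiv.sum_comp (Equiv.mulRight (Equiv.swap i j)) fun σ : Equiv.Perm (Fin s) => x (σ i)]
    simp
  have hs : (s : ℝ) ≠ 0 := by
    have := i.pos
    positivity
  have hc : (Fintype.card (Equiv.Perm (Fin s)) : ℝ) ≠ 0 := by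
    exact_mod_cast Fintype.card_ne_zero
  have h2 : (s : ℝ) • ∑ σ : Equiv.Perm (Fin s), x (σ i) =
      (Fintype.card (Equiv.Perm (Fin s)) : ℝ) • ∑ j, x j := by
    calc (s : ℝ) • ∑ σ : Equiv.Perm (Fin s), x (σ i)
        = ∑ j, ∑ σ : Equiv.Perm (Fin s), x (σ j) := by
          rw [Finset.sum_congr rfl fun j _ => (h1 j).symm]
          simp [Nat.cast_smul_eq_nsmul]
      _ = ∑ σ : Equiv.Perm (Fin s), ∑ j, x j := by
          rw [Finset.sum_comm]
          exact Finset.sum_congr rfl fun σ _ => Equiv.sum_comp σ x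
      _ = _ := by rw [Finset.sum_const, Finset.card_univ, Nat.cast_smul_eq_nsmul]
  rw [← Finset.smul_sum, inv_smul_eq_iff₀ hc, smul_comm, ← h2, inv_smul_smul₀ hs]

/-- Averaging over all relabellings, a batch with repetitions has the larger convex mean. -/
theorem sum_perm_convex_le {m s : ℕ} {V : Type*} [AddCommGroup V] [Module ℝ V] {C : Set V}
    {φ : V → ℝ} (hφ : ConvexOn ℝ C φ) (X : Fin m → V)
    (hC : ∀ S : Fin s → Fin m, ∑ j, X (S j) ∈ C) (J : Fin s ↪ Fin m) (t : Fin s → Fin s) :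
    ∑ π : Equiv.Perm (Fin m), φ (∑ j, X (π (J j))) ≤
      ∑ π : Equiv.Perm (Fin m), φ (∑ j, X (π (J (t j)))) := by
  set N : ℝ := ((Fintype.card (Equiv.Perm (Fin s)) : ℕ) : ℝ) with hN
  have hNpos : 0 < N := by
    rw [hN]
    exact_mod_cast Fintype.card_pos
  have h1 : ∀ π : Equiv.Perm (Fin m), φ (∑ j, X (π (J j))) ≤
      ∑ σ : Equiv.Perm (Fin s), N⁻¹ * φ (∑ j, X (π (J (σ (t j))))) := by
    intro π
    have h2 := hφ.map_sum_le (t := (Finset.univ : Finset (Equiv.Perm (Fin s))))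
      (w := fun _ => N⁻¹) (p := fun σ => ∑ j, X (π (J (σ (t j)))))
      (fun _ _ => (inv_pos.2 hNpos).le)
      (by rw [Finset.sum_const, Finset.card_univ, nsmul_eq_mul, ← hN, mul_inv_cancel₀ hNpos.ne'])
      (fun σ _ => hC fun j => π (J (σ (t j))))
    -- Averaged over `σ`, each of the `s` terms becomes the mean of the repetition-free batch,
    -- whatever `t` repeats. This makes Jensen applicable.
    have h3 : ∑ σ : Equiv.Perm (Fin s), N⁻¹ • ∑ j, X (π (J (σ (t j)))) = ∑ j, X (π (J j)) := by
      simp only [Finset.smul_sum]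
      rw [Finset.sum_comm]
      rw [Finset.sum_congr rfl fun j _ => sum_perm_apply (fun i => X (π (J i))) (t j)]
      rw [Finset.sum_const, Finset.card_univ, Fintype.card_fin]
      rcases Nat.eq_zero_or_pos s with rfl | hs
      · simp
      · rw [← Nat.cast_smul_eq_nsmul ℝ, smul_inv_smul₀ (by positivity)]
    rw [h3] at h2
    simpa using h2
  refine (Finset.sum_le_sum fun π _ => h1 π).trans_eq ?_
  rw [Finset.sum_comm]
  have h4 : ∀ σ : Equiv.Perm (Fin s),
      ∑ π : Equiv.Perm (Fin m), φ (∑ j, X (π (J (σ (t j))))) =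
      ∑ π : Equiv.Perm (Fin m), φ (∑ j, X (π (J (t j)))) := fun σ =>
    sum_perm_comp_embedding (fun S => φ (∑ j, X (S (t j)))) (σ.toEmbedding.trans J) J
  simp only [← Finset.mul_sum, h4, Finset.sum_const, Finset.card_univ, nsmul_eq_mul]
  rw [← hN, inv_mul_cancel_left₀ hNpos.ne']

open Classical in
/-- The batches as a finite set. -/
noncomputable def Sampling.batchFinset (T : Sampling) (s m : ℕ) : Finset (Fin s → Fin m) :=
  Finset.univ.filter (· ∈ T.batches s m)

theorem Sampling.mem_batchFinset {T : Sampling} {s m : ℕ} {S : Fin s → Fin m} :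
    S ∈ T.batchFinset s m ↔ S ∈ T.batches s m := by simp [Sampling.batchFinset]

theorem Sampling.comp_perm_mem {T : Sampling} {s m : ℕ} (π : Equiv.Perm (Fin m))
    {S : Fin s → Fin m} : π ∘ S ∈ T.batches s m ↔ S ∈ T.batches s m := by
  cases T <;> simp [Sampling.batches]

theorem Sampling.card_mul_sum {T : Sampling} {s m : ℕ} (F : (Fin s → Fin m) → ℝ) :
    (Fintype.card (Equiv.Perm (Fin m)) : ℝ) * ∑ S ∈ T.batchFinset s m, F S =
      ∑ S ∈ T.batchFinset s m, ∑ π : Equiv.Perm (Fin m), F (π ∘ S) := by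
  have h1 : ∀ π : Equiv.Perm (Fin m), ∑ S ∈ T.batchFinset s m, F (π ∘ S) =
      ∑ S ∈ T.batchFinset s m, F S := fun π =>
    Finset.sum_equiv ((Equiv.refl (Fin s)).arrowCongr π)
      (fun S => by
        simp only [Sampling.mem_batchFinset]
        exact (Sampling.comp_perm_mem π (S := S)).symm) (fun S _ => rfl)
  rw [Finset.sum_comm]
  simp [h1]

/-- Hoeffding's comparison of sampling without and with replacement, for convex functions of the
sum of the batch. -/
theorem Sampling.card_mul_sum_convex_le (T : Sampling) {m s : ℕ} {V : Type*} [AddCommGroup V]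
    [Module ℝ V] {C : Set V} {φ : V → ℝ} (hφ : ConvexOn ℝ C φ) (X : Fin m → V)
    (hC : ∀ S : Fin s → Fin m, ∑ j, X (S j) ∈ C) :
    (Fintype.card (Fin s → Fin m) : ℝ) * ∑ S ∈ T.batchFinset s m, φ (∑ j, X (S j)) ≤
      (T.batchFinset s m).card * ∑ S : Fin s → Fin m, φ (∑ j, X (S j)) := by
  cases T with
  | withReplacement =>
    have h : Sampling.withReplacement.batchFinset s m = Finset.univ := by
      ext S
      simp [Sampling.mem_batchFinset, Sampling.batches]
    rw [h, Finset.card_univ]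
  | withoutReplacement =>
    rcases lt_or_ge m s with hms | hms
    · have h : Sampling.withoutReplacement.batchFinset s m = ∅ := by
        ext S
        simp only [Sampling.mem_batchFinset, Sampling.batches, Set.mem_ofPred_eq,
          Finset.notMem_empty, iff_false]
        intro hS
        have := Fintype.card_le_of_injective S hS
        simp at this
        omega
      simp [h]
    set J : Fin s ↪ Fin m := Fin.castLEEmb hms
    set N : ℝ := ((Fintype.card (Equiv.Perm (Fin m)) : ℕ) : ℝ) with hN
    have hNpos : 0 < N := by
      rw [hN]
      exact_mod_cast Fintype.card_pos
    -- Averaging over relabellings compares both means with `Q`: each injective batch gives exactly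
    -- `Q`, an arbitrary one at least `Q`.
    set Q : ℝ := ∑ π : Equiv.Perm (Fin m), φ (∑ j, X (π (J j))) with hQ
    have h1 : N * ∑ S ∈ Sampling.withoutReplacement.batchFinset s m, φ (∑ j, X (S j)) =
        (Sampling.withoutReplacement.batchFinset s m).card * Q := by
      rw [Sampling.card_mul_sum fun S => φ (∑ j, X (S j)), ← nsmul_eq_mul]
      refine Finset.sum_eq_card_nsmul fun S hS => ?_
      rw [Sampling.mem_batchFinset] at hS
      exact sum_perm_comp_embedding (fun S => φ (∑ j, X (S j))) ⟨S, hS⟩ J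
    have h2 : (Fintype.card (Fin s → Fin m) : ℝ) * Q ≤
        N * ∑ S : Fin s → Fin m, φ (∑ j, X (S j)) := by
      have h3 := Sampling.card_mul_sum (T := .withReplacement) (s := s) (m := m)
        fun S => φ (∑ j, X (S j))
      have h : Sampling.withReplacement.batchFinset s m = Finset.univ := by
        ext S
        simp [Sampling.mem_batchFinset, Sampling.batches]
      rw [h] at h3
      rw [h3, ← nsmul_eq_mul, ← Finset.card_univ]
      refine Finset.card_nsmul_le_sum _ _ _ fun Z _ => ?_
      obtain ⟨J', t, rfl⟩ := exists_embedding_factor hms Z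
      calc Q = ∑ π : Equiv.Perm (Fin m), φ (∑ j, X (π (J' j))) :=
            sum_perm_comp_embedding (fun S => φ (∑ j, X (S j))) J J'
        _ ≤ _ := sum_perm_convex_le hφ X hC J' t
    refine le_of_mul_le_mul_left ?_ hNpos
    calc _ = (Fintype.card (Fin s → Fin m) : ℝ) *
          (N * ∑ S ∈ Sampling.withoutReplacement.batchFinset s m, φ (∑ j, X (S j))) := by ring
      _ = (Sampling.withoutReplacement.batchFinset s m).card *
          ((Fintype.card (Fin s → Fin m) : ℝ) * Q) := by rw [h1]; ring
      _ ≤ (Sampling.withoutReplacement.batchFinset s m).card *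
          (N * ∑ S : Fin s → Fin m, φ (∑ j, X (S j))) :=
          mul_le_mul_of_nonneg_left h2 (Nat.cast_nonneg _)
      _ = _ := by ring

/-- Markov's inequality for a convex function of the sum of a batch. -/
theorem Sampling.uniformOn_le (T : Sampling) {m s : ℕ} (hm : 0 < m) {V : Type*} [AddCommGroup V]
    [Module ℝ V] {C : Set V} {φ : V → ℝ} (hφ : ConvexOn ℝ C φ) (X : Fin m → V)
    (hC : ∀ S : Fin s → Fin m, ∑ j, X (S j) ∈ C) (hφ0 : ∀ v, 0 ≤ φ v)
    {E : Set (Fin s → Fin m)} {c M : ℝ} (hc : 0 < c) (hE : ∀ S ∈ E, c ≤ φ (∑ j, X (S j)))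
    (hM : ∑ S : Fin s → Fin m, φ (∑ j, X (S j)) ≤ Fintype.card (Fin s → Fin m) * M) :
    uniformOn (T.batches s m) E ≤ ENNReal.ofReal (M / c) := by
  classical
  have : Nonempty (Fin m) := ⟨⟨0, hm⟩⟩
  have hcoe : T.batches s m = (T.batchFinset s m : Set (Fin s → Fin m)) := by
    ext S
    simp [Sampling.mem_batchFinset]
  have hcoeE : E = (Finset.univ.filter (· ∈ E) : Finset (Fin s → Fin m)) := by
    ext S
    simp
  have hN : (0 : ℝ) < Fintype.card (Fin s → Fin m) := by exact_mod_cast Fintype.card_pos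
  have h1 := T.card_mul_sum_convex_le hφ X hC
  have h2 : ((T.batchFinset s m ∩ Finset.univ.filter (· ∈ E)).card : ℝ) * c ≤
      ∑ S ∈ T.batchFinset s m, φ (∑ j, X (S j)) := by
    rw [← nsmul_eq_mul]
    refine (Finset.card_nsmul_le_sum _ _ c fun S hS => hE S ?_).trans
      (Finset.sum_le_sum_of_subset_of_nonneg Finset.inter_subset_left fun _ _ _ => hφ0 _)
    simpa using (Finset.mem_inter.1 hS).2
  have h3 : ((T.batchFinset s m ∩ Finset.univ.filter (· ∈ E)).card : ℝ) * c ≤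
      (T.batchFinset s m).card * M := by
    refine le_of_mul_le_mul_left ?_ hN
    calc _ ≤ _ := mul_le_mul_of_nonneg_left h2 hN.le
      _ ≤ _ := h1
      _ ≤ (T.batchFinset s m).card * (Fintype.card (Fin s → Fin m) * M) :=
          mul_le_mul_of_nonneg_left hM (Nat.cast_nonneg _)
      _ = _ := by ring
  rw [hcoe, hcoeE, uniformOn_apply_finset]
  -- There may be no batch at all (`s > m` without replacement); the ratio is then `0 / 0 = 0`.
  rcases (T.batchFinset s m).card.eq_zero_or_pos with h0 | h0
  · rw [Finset.card_eq_zero] at h0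
    simp [h0]
  · have h0' : (0 : ℝ) < (T.batchFinset s m).card := by exact_mod_cast h0
    rw [← ENNReal.ofReal_natCast, ← ENNReal.ofReal_natCast (T.batchFinset s m).card,
      ← ENNReal.ofReal_div_of_pos h0']
    refine ENNReal.ofReal_le_ofReal ?_
    rw [div_le_div_iff₀ h0' hc]
    linarith

end Batches

/-! ### Exponential moments of batches drawn with replacement -/

section Moments

/-- Hoeffding's lemma for the uniform distribution on a finite type. -/
theorem sum_exp_le_of_abs_sub_le {α : Type*} [Fintype α] [Nonempty α] (G : α → ℝ) {c : ℝ}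
    (hG : ∀ a b, |G a - G b| ≤ c) (θ : ℝ) :
    ∑ a, Real.exp (θ * G a) ≤ Fintype.card α *
      Real.exp (θ * ((∑ a, G a) / Fintype.card α) + θ ^ 2 * c ^ 2 / 8) := by
  let _ : MeasurableSpace α := ⊤
  have : MeasurableSingletonClass α := ⟨fun _ => trivial⟩
  set P : Measure α := (PMF.uniformOfFintype α).toMeasure
  have hint : ∀ f : α → ℝ, ∫ a, f a ∂P = (∑ a, f a) / Fintype.card α := fun f => by
    rw [PMF.integral_eq_sum]
    simp [PMF.uniformOfFintype_apply, ← Finset.mul_sum, div_eq_inv_mul]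
  obtain ⟨a₀, ha₀⟩ := Finite.exists_min G
  have hc : 0 ≤ c := (abs_nonneg _).trans (hG a₀ a₀)
  have h1 := hasSubgaussianMGF_of_mem_Icc (μ := P) (X := G) (a := G a₀) (b := G a₀ + c)
    (measurable_from_top.aemeasurable) (Filter.Eventually.of_forall fun a =>
      ⟨ha₀ a, by linarith [(abs_le.1 (hG a a₀)).2]⟩)
  have h2 := h1.mgf_le θ
  rw [mgf, hint, hint] at h2
  have hN : (0 : ℝ) < Fintype.card α := by exact_mod_cast Fintype.card_pos
  rw [div_le_iff₀ hN] at h2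
  set g := (∑ a, G a) / (Fintype.card α : ℝ)
  have h3 : ((((‖G a₀ + c - G a₀‖₊ / 2) ^ 2 : NNReal) : ℝ)) * θ ^ 2 / 2 = θ ^ 2 * c ^ 2 / 8 := by
    push_cast
    rw [add_sub_cancel_left, Real.norm_eq_abs, div_pow, sq_abs]
    ring
  rw [h3] at h2
  calc ∑ a, Real.exp (θ * G a) = Real.exp (θ * g) * ∑ a, Real.exp (θ * (G a - g)) := by
        rw [Finset.mul_sum]
        refine Finset.sum_congr rfl fun a _ => ?_
        rw [← Real.exp_add]
        ring_nf
    _ ≤ Real.exp (θ * g) * (Real.exp (θ ^ 2 * c ^ 2 / 8) * Fintype.card α) :=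
        mul_le_mul_of_nonneg_left h2 (Real.exp_pos _).le
    _ = _ := by rw [Real.exp_add]; ring

/-- McDiarmid's bound on the moment generating function. -/
theorem sum_exp_le_of_bounded_differences {α : Type*} [Fintype α] [Nonempty α] {c : ℝ} (θ : ℝ)
    {s : ℕ} (F : (Fin s → α) → ℝ) (hF : ∀ S i a, |F S - F (Function.update S i a)| ≤ c) :
    ∑ S, Real.exp (θ * F S) ≤ Fintype.card (Fin s → α) *
      Real.exp (θ * ((∑ S, F S) / Fintype.card (Fin s → α)) + s * (θ ^ 2 * c ^ 2 / 8)) := by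
  induction s with
  | zero => simp
  | succ s ih =>
    have hN : (0 : ℝ) < Fintype.card (Fin s → α) := by exact_mod_cast Fintype.card_pos
    have hcard : (Fintype.card (Fin (s + 1) → α) : ℝ) =
        Fintype.card α * Fintype.card (Fin s → α) := by
      simp [pow_succ, mul_comm]
    set N : ℝ := ((Fintype.card (Fin s → α) : ℕ) : ℝ)
    -- The conditional mean given the first draw varies by at most `c`. Hoeffding's lemma handles
    -- it, and induction handles the remaining draws.
    set G : α → ℝ := fun a => (∑ S : Fin s → α, F (Fin.cons a S)) / N with hGdef
    have h1 : ∀ a, ∑ S : Fin s → α, Real.exp (θ * F (Fin.cons a S)) ≤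
        N * Real.exp (s * (θ ^ 2 * c ^ 2 / 8)) * Real.exp (θ * G a) := fun a => by
      refine (ih (fun S => F (Fin.cons a S)) fun S i b => ?_).trans_eq ?_
      · rw [Fin.cons_update]
        exact hF _ _ _
      · rw [Real.exp_add]
        ring
    have h2 : ∀ a b, |G a - G b| ≤ c := fun a b => by
      rw [hGdef]
      simp only
      rw [← sub_div, ← Finset.sum_sub_distrib, abs_div, abs_of_pos hN, div_le_iff₀ hN]
      refine (Finset.abs_sum_le_sum_abs _ _).trans ?_
      refine (Finset.sum_le_card_nsmul _ _ c fun S _ => ?_).trans_eq ?_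
      · have := hF (Fin.cons a S) 0 b
        rwa [Fin.update_cons_zero] at this
      · rw [nsmul_eq_mul, mul_comm, Finset.card_univ]
    have h3 := sum_exp_le_of_abs_sub_le G h2 θ
    have h4 : (∑ S, F S) / Fintype.card (Fin (s + 1) → α) = (∑ a, G a) / Fintype.card α := by
      rw [sum_fin_succ_fun, hcard, hGdef, ← Finset.sum_div, div_div, mul_comm]
    rw [sum_fin_succ_fun, h4]
    calc _ ≤ ∑ a, N * Real.exp (s * (θ ^ 2 * c ^ 2 / 8)) * Real.exp (θ * G a) :=
          Finset.sum_le_sum fun a _ => h1 a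
      _ = N * Real.exp (s * (θ ^ 2 * c ^ 2 / 8)) * ∑ a, Real.exp (θ * G a) := by
          rw [Finset.mul_sum]
      _ ≤ N * Real.exp (s * (θ ^ 2 * c ^ 2 / 8)) * _ :=
          mul_le_mul_of_nonneg_left h3 (by positivity)
      _ = _ := by
          rw [hcard, show ((s + 1 : ℕ) : ℝ) * (θ ^ 2 * c ^ 2 / 8) =
            s * (θ ^ 2 * c ^ 2 / 8) + θ ^ 2 * c ^ 2 / 8 by push_cast; ring, Real.exp_add,
            Real.exp_add, Real.exp_add]
          ring

/-- Variances of independent draws add: the cross terms vanish because `Y` is centred. -/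
theorem sum_norm_sum_sq_eq {α V : Type*} [Fintype α] [Nonempty α] [NormedAddCommGroup V]
    [InnerProductSpace ℝ V] (Y : α → V) (hY : ∑ a, Y a = 0) (s : ℕ) :
    ∑ S : Fin s → α, ‖∑ j, Y (S j)‖ ^ 2 =
      s * Fintype.card (Fin s → α) * ((∑ a, ‖Y a‖ ^ 2) / Fintype.card α) := by
  induction s with
  | zero => simp
  | succ s ih =>
    rw [sum_fin_succ_fun]
    simp only [Fin.sum_univ_succ, Fin.cons_zero, Fin.cons_succ]
    have h1 : ∀ a (S : Fin s → α), ‖Y a + ∑ j, Y (S j)‖ ^ 2 =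
        ‖Y a‖ ^ 2 + ‖∑ j, Y (S j)‖ ^ 2 + 2 * ⟪Y a, ∑ j, Y (S j)⟫ := fun a S => by
      rw [norm_add_sq_real]
      ring
    have h2 : ∑ a, ∑ S : Fin s → α, ⟪Y a, ∑ j, Y (S j)⟫ = 0 := by
      rw [Finset.sum_comm]
      simp [← sum_inner, hY]
    simp only [h1, Finset.sum_add_distrib, ih, Finset.sum_const, Finset.card_univ,
      nsmul_eq_mul, ← Finset.mul_sum, h2]
    have hN : (0 : ℝ) < Fintype.card α := by exact_mod_cast Fintype.card_pos
    have hcard : (Fintype.card (Fin (s + 1) → α) : ℝ) =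
        Fintype.card α * Fintype.card (Fin s → α) := by
      simp [pow_succ, mul_comm]
    rw [hcard]
    push_cast
    field_simp
    ring

theorem sum_norm_sum_le {α V : Type*} [Fintype α] [Nonempty α] [NormedAddCommGroup V]
    [InnerProductSpace ℝ V] (Y : α → V) (hY : ∑ a, Y a = 0) {U : ℝ} (hU : 0 ≤ U)
    (hYU : ∑ a, ‖Y a‖ ^ 2 ≤ Fintype.card α * U ^ 2) (s : ℕ) :
    (∑ S : Fin s → α, ‖∑ j, Y (S j)‖) / Fintype.card (Fin s → α) ≤ √s * U := by
  have hN : (0 : ℝ) < Fintype.card (Fin s → α) := by exact_mod_cast Fintype.card_pos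
  have hM : (0 : ℝ) < Fintype.card α := by exact_mod_cast Fintype.card_pos
  rw [div_le_iff₀ hN]
  refine le_of_sq_le_sq ?_ (by positivity)
  have h1 := sq_sum_le_card_mul_sum_sq (s := (Finset.univ : Finset (Fin s → α)))
    (f := fun S => ‖∑ j, Y (S j)‖)
  rw [sum_norm_sum_sq_eq Y hY, Finset.card_univ] at h1
  refine h1.trans ?_
  rw [mul_pow, mul_pow, Real.sq_sqrt (Nat.cast_nonneg s)]
  have h2 : (∑ a, ‖Y a‖ ^ 2) / Fintype.card α ≤ U ^ 2 := by
    rw [div_le_iff₀ hM]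
    linarith
  calc _ ≤ (Fintype.card (Fin s → α) : ℝ) * (s * Fintype.card (Fin s → α) * U ^ 2) := by gcongr
    _ = _ := by ring

/-- Centring does not increase the second moment, so the expected norm is controlled with `U`
instead of `2 * U`. -/
theorem sum_norm_sub_mean_sq_le {α V : Type*} [Fintype α] [NormedAddCommGroup V]
    [InnerProductSpace ℝ V] (X : α → V) {μ : V} (hμ : ∑ a, (X a - μ) = 0) :
    ∑ a, ‖X a - μ‖ ^ 2 ≤ ∑ a, ‖X a‖ ^ 2 := by
  have h1 : ∀ a, ‖X a‖ ^ 2 = ‖X a - μ‖ ^ 2 + ‖μ‖ ^ 2 + 2 * ⟪X a - μ, μ⟫ := fun a => by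
    have := norm_add_sq_real (X a - μ) μ
    rw [sub_add_cancel] at this
    rw [this]
    ring
  have h2 : ∑ a, 2 * ⟪X a - μ, μ⟫ = 0 := by
    rw [← Finset.mul_sum, ← sum_inner, hμ, inner_zero_left, mul_zero]
  simp only [h1, Finset.sum_add_distrib, h2, add_zero]
  have : 0 ≤ ∑ _a : α, ‖μ‖ ^ 2 := Finset.sum_nonneg fun _ _ => sq_nonneg _
  linarith

/-- Changing one draw moves the norm of the sum by at most `2 * U`; McDiarmid's bound is centred at
the mean norm, itself at most `√s * U`. -/
theorem sum_exp_norm_sum_le {α V : Type*} [Fintype α] [Nonempty α] [NormedAddCommGroup V]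
    [InnerProductSpace ℝ V] (Y : α → V) (hY : ∑ a, Y a = 0) {U : ℝ} (hU : 0 ≤ U)
    (hYU : ∑ a, ‖Y a‖ ^ 2 ≤ Fintype.card α * U ^ 2) (hD : ∀ a b, ‖Y a - Y b‖ ≤ 2 * U)
    {θ : ℝ} (hθ : 0 ≤ θ) (s : ℕ) :
    ∑ S : Fin s → α, Real.exp (θ * ‖∑ j, Y (S j)‖) ≤ Fintype.card (Fin s → α) *
      Real.exp (θ * (√s * U) + s * (θ ^ 2 * U ^ 2 / 2)) := by
  refine (sum_exp_le_of_bounded_differences (c := 2 * U) θ _ fun S i a => ?_).trans ?_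
  · refine (abs_norm_sub_norm_le _ _).trans ?_
    rw [sum_sub_sum_update]
    exact hD _ _
  · have := sum_norm_sum_le Y hY hU hYU s
    have h2 : θ ^ 2 * (2 * U) ^ 2 / 8 = θ ^ 2 * U ^ 2 / 2 := by ring
    rw [h2]
    gcongr

/-- Since `Y` is centred, `Y (S i)` may be replaced by the average of `Y (S i) - Y c` over a fresh
draw `c`. Adding the same sum with the two draws swapped doubles it and produces the left side of
`SymmOp.sinhTrace_exchange_le`. -/
theorem sum_sinhTrace_le {n m s : ℕ} (hm : 0 < m) (Y : Fin m → Op n)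
    (hsymm : ∀ a, SymmOp (Y a)) (hY : ∑ a, Y a = 0) {D θ : ℝ} (hD : ∀ a b, ‖Y a - Y b‖ ≤ D)
    (hθ : 0 ≤ θ) (i : Fin s) :
    ∑ S : Fin s → Fin m, sinhTrace θ (∑ j, Y (S j)) (Y (S i)) ≤
      θ / 2 * D ^ 2 * ∑ S : Fin s → Fin m, coshTrace θ (∑ j, Y (S j)) := by
  have hM : ∀ S : Fin s → Fin m, SymmOp (∑ j, Y (S j)) := fun S =>
    SymmOp.sum _ fun j _ => hsymm _
  have h1 : (m : ℝ) * ∑ S : Fin s → Fin m, sinhTrace θ (∑ j, Y (S j)) (Y (S i)) =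
      ∑ S : Fin s → Fin m, ∑ c, sinhTrace θ (∑ j, Y (S j)) (Y (S i) - Y c) := by
    rw [Finset.mul_sum]
    refine Finset.sum_congr rfl fun S _ => ?_
    rw [← sinhTrace_sum, Finset.sum_sub_distrib, hY, sub_zero, Finset.sum_const, Finset.card_univ,
      Fintype.card_fin]
    simp [sinhTrace, Finset.mul_sum, inner_smul_right, ← Nat.cast_smul_eq_nsmul ℝ]
    exact Finset.sum_congr rfl fun _ _ => by ring
  have h2 := sum_sum_update i fun (S : Fin s → Fin m) c =>
    sinhTrace θ (∑ j, Y (S j)) (Y (S i) - Y c)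
  have h3 := sum_sum_update i fun (S : Fin s → Fin m) (_ : Fin m) => coshTrace θ (∑ j, Y (S j))
  have h4 : ∀ (S : Fin s → Fin m) (c : Fin m),
      sinhTrace θ (∑ j, Y (S j)) (Y (S i) - Y c) +
      sinhTrace θ (∑ j, Y (Function.update S i c j)) (Y (Function.update S i c i) - Y (S i)) ≤
      θ / 2 * D ^ 2 * (coshTrace θ (∑ j, Y (S j)) +
        coshTrace θ (∑ j, Y (Function.update S i c j))) := fun S c => by
    have h5 := sum_sub_sum_update Y S i c
    have h6 := (hM S).sinhTrace_exchange_le (hM (Function.update S i c)) hθ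
      (D := D) (h5 ▸ hD _ _)
    rw [← neg_sub (∑ j, Y (S j)), h5, neg_sub] at h6
    simpa using h6
  have h5 := Finset.sum_le_sum fun S (_ : S ∈ (Finset.univ : Finset (Fin s → Fin m))) =>
    Finset.sum_le_sum fun c (_ : c ∈ (Finset.univ : Finset (Fin m))) => h4 S c
  simp only [Finset.sum_add_distrib, ← Finset.mul_sum, h2, h3, ← h1] at h5
  simp only [Finset.sum_const, Finset.card_univ, Fintype.card_fin, nsmul_eq_mul,
    ← Finset.mul_sum] at h5
  have hm' : (0 : ℝ) < m := by exact_mod_cast hm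
  refine le_of_mul_le_mul_left ?_ hm'
  linarith

/-- The trace bound for the sum of a batch of symmetric operators drawn with replacement. -/
theorem sum_coshTrace_le {n m : ℕ} (hm : 0 < m) (Y : Fin m → Op n)
    (hsymm : ∀ a, SymmOp (Y a)) (hY : ∑ a, Y a = 0) {D θ : ℝ} (hD : ∀ a b, ‖Y a - Y b‖ ≤ D)
    (hθ : 0 ≤ θ) (s : ℕ) :
    ∑ S : Fin s → Fin m, coshTrace θ (∑ j, Y (S j)) ≤
      Fintype.card (Fin s → Fin m) * (n * Real.exp (s * D ^ 2 / 4 * θ ^ 2)) := by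
  set h : ℝ → ℝ := fun t => ∑ S : Fin s → Fin m, coshTrace t (∑ j, Y (S j)) with hh
  set κ : ℝ := s * D ^ 2 / 4
  have hder : ∀ t, HasDerivAt h
      (∑ S : Fin s → Fin m, sinhTrace t (∑ j, Y (S j)) (∑ j, Y (S j))) t := fun t =>
    HasDerivAt.fun_sum fun S _ => hasDerivAt_coshTrace _ _
  have hle : ∀ t, 0 ≤ t →
      ∑ S : Fin s → Fin m, sinhTrace t (∑ j, Y (S j)) (∑ j, Y (S j)) ≤ 2 * κ * t * h t := by
    intro t ht
    simp only [sinhTrace_sum]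
    rw [Finset.sum_comm]
    refine (Finset.sum_le_card_nsmul _ _ _ fun i _ =>
      sum_sinhTrace_le hm Y hsymm hY hD ht i).trans_eq ?_
    simp only [Finset.card_univ, Fintype.card_fin, nsmul_eq_mul, κ, hh]
    ring
  have hE : ∀ t, HasDerivAt (fun t => Real.exp (-(κ * t ^ 2)))
      (Real.exp (-(κ * t ^ 2)) * -(κ * (2 * t))) t := fun t => by
    have := (((hasDerivAt_pow 2 t).const_mul κ).neg).exp
    simpa using this
  -- Grönwall's argument for `h' ≤ 2 * κ * t * h`, starting from a trace of the identity at `t = 0`.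
  have hanti : AntitoneOn (fun t => h t * Real.exp (-(κ * t ^ 2))) (Set.Ici 0) := by
    have hd : ∀ t, HasDerivAt (fun t => h t * Real.exp (-(κ * t ^ 2))) _ t := fun t =>
      (hder t).mul (hE t)
    refine antitoneOn_of_deriv_nonpos (convex_Ici 0)
      (fun t _ => (hd t).continuousAt.continuousWithinAt)
      (fun t _ => (hd t).differentiableAt.differentiableWithinAt) fun t ht => ?_
    rw [interior_Ici, Set.mem_Ioi] at ht
    rw [(hd t).deriv]
    have := mul_le_mul_of_nonneg_right (hle t ht.le) (Real.exp_pos (-(κ * t ^ 2))).le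
    linarith
  have h1 := hanti (Set.mem_Ici.2 le_rfl) (Set.mem_Ici.2 hθ) hθ
  have h0 : h 0 = Fintype.card (Fin s → Fin m) * n := by simp [hh, coshTrace_zero]
  simp only [h0, Real.exp_neg] at h1
  rw [← div_eq_mul_inv, div_le_iff₀ (Real.exp_pos _)] at h1
  refine h1.trans_eq ?_
  simp
  ring

end Moments

/-! ### Accuracy of batch means -/

section Tails

theorem sum_sub_mean {m : ℕ} (hm : 0 < m) {V : Type*} [AddCommGroup V] [Module ℝ V]
    (X : Fin m → V) : ∑ a, (X a - (m : ℝ)⁻¹ • ∑ b, X b) = 0 := by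
  have hm' : (m : ℝ) ≠ 0 := by positivity
  rw [Finset.sum_sub_distrib, Finset.sum_const, Finset.card_univ, Fintype.card_fin,
    ← Nat.cast_smul_eq_nsmul ℝ, smul_inv_smul₀ hm', sub_self]

theorem lt_norm_sum_sub {m s : ℕ} (hs : 0 < s) {V : Type*} [NormedAddCommGroup V]
    [NormedSpace ℝ V] (X : Fin m → V) (μ : V) (S : Fin s → Fin m) {t : ℝ}
    (h : t < ‖(s : ℝ)⁻¹ • ∑ j, X (S j) - μ‖) : s * t < ‖∑ j, (X (S j) - μ)‖ := by
  have hs' : (0 : ℝ) < s := by exact_mod_cast hs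
  have h1 : ∑ j, (X (S j) - μ) = (s : ℝ) • ((s : ℝ)⁻¹ • ∑ j, X (S j) - μ) := by
    rw [smul_sub, smul_inv_smul₀ hs'.ne', Finset.sum_sub_distrib, Finset.sum_const,
      Finset.card_univ, Fintype.card_fin, ← Nat.cast_smul_eq_nsmul ℝ]
  rw [h1, norm_smul, Real.norm_of_nonneg hs'.le]
  exact mul_lt_mul_of_pos_left h hs'

theorem convexOn_exp_mul_norm {V : Type*} [NormedAddCommGroup V] [NormedSpace ℝ V] {θ : ℝ}
    (hθ : 0 ≤ θ) : ConvexOn ℝ Set.univ fun v : V => Real.exp (θ * ‖v‖) := by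
  refine ⟨convex_univ, fun v _ w _ a b ha hb hab => ?_⟩
  refine le_trans ?_ (convexOn_exp.2 (Set.mem_univ (θ * ‖v‖)) (Set.mem_univ (θ * ‖w‖)) ha hb hab)
  refine Real.exp_le_exp.2 ?_
  calc θ * ‖a • v + b • w‖ ≤ θ * (a * ‖v‖ + b * ‖w‖) := by
        refine mul_le_mul_of_nonneg_left ((norm_add_le _ _).trans_eq ?_) hθ
        rw [norm_smul, norm_smul, Real.norm_of_nonneg ha, Real.norm_of_nonneg hb]
    _ = _ := by simp only [smul_eq_mul]; ring

/-- Concentration of the mean of a batch of vectors. -/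
theorem Sampling.uniformOn_norm_mean_sub_le (T : Sampling) {m s : ℕ} (hm : 0 < m) {V : Type*}
    [NormedAddCommGroup V] [InnerProductSpace ℝ V] (X : Fin m → V) {U ε δ : ℝ} (hU : 0 < U)
    (hε : 0 < ε) (hδ : 0 < δ) (hδ1 : δ < 1) (hX : ∀ a, ‖X a‖ ≤ U)
    (hs : 9 * U ^ 2 * (1 + √(8 * Real.log (1 / δ))) ^ 2 / ε ^ 2 ≤ (s : ℝ)) :
    uniformOn (T.batches s m)
      {S | ε / 3 < ‖(s : ℝ)⁻¹ • ∑ j, X (S j) - (m : ℝ)⁻¹ • ∑ a, X a‖} ≤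
      ENNReal.ofReal (δ ^ 4) := by
  have : Nonempty (Fin m) := ⟨⟨0, hm⟩⟩
  set ℓ := Real.log (1 / δ) with hℓ
  have hℓ0 : 0 < ℓ := Real.log_pos (by rw [lt_div_iff₀ hδ]; linarith)
  set q := √(8 * ℓ) with hq
  have hq0 : 0 ≤ q := Real.sqrt_nonneg _
  have hq2 : q ^ 2 = 8 * ℓ := Real.sq_sqrt (by positivity)
  have hs0 : (0 : ℝ) < s := lt_of_lt_of_le (by positivity) hs
  have hrs : 0 < √(s : ℝ) := Real.sqrt_pos.2 hs0
  have hrs2 : √(s : ℝ) ^ 2 = s := Real.sq_sqrt hs0.le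
  set μ : V := (m : ℝ)⁻¹ • ∑ a, X a with hμ
  have hY : ∑ a, (X a - μ) = 0 := sum_sub_mean hm X
  -- This `θ` minimizes the exponent. The batch size leaves room for the mean norm plus a deviation
  -- `q * √s * U`, so the exponent becomes `-q ^ 2 / 2 = -4 * ℓ`.
  set θ := q / (√s * U) with hθ
  have hθ0 : 0 ≤ θ := by positivity
  have hthr : √s * U * (1 + q) ≤ s * (ε / 3) := by
    rw [div_le_iff₀ (by positivity)] at hs
    have h1 : (3 * U * (1 + q)) ^ 2 ≤ (√s * ε) ^ 2 := by
      rw [mul_pow (√(s : ℝ)), hrs2]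
      refine le_trans (le_of_eq ?_) hs
      ring
    have h2 := abs_le_of_sq_le_sq' h1 (by positivity)
    calc √s * U * (1 + q) = √s / 3 * (3 * U * (1 + q)) := by ring
      _ ≤ √s / 3 * (√s * ε) := mul_le_mul_of_nonneg_left h2.2 (by positivity)
      _ = √(s : ℝ) ^ 2 * (ε / 3) := by ring
      _ = _ := by rw [hrs2]
  have h1 := T.uniformOn_le (s := s) hm (convexOn_exp_mul_norm hθ0) (fun a => X a - μ)
    (fun _ => Set.mem_univ _) (fun _ => (Real.exp_pos _).le)
    (E := {S | ε / 3 < ‖(s : ℝ)⁻¹ • ∑ j, X (S j) - μ‖})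
    (Real.exp_pos (θ * (√s * U * (1 + q)))) (fun S hS => by
      refine Real.exp_le_exp.2 (mul_le_mul_of_nonneg_left ?_ hθ0)
      exact hthr.trans (lt_norm_sum_sub (by exact_mod_cast hs0) X μ S hS).le)
    (sum_exp_norm_sum_le _ hY hU.le
      ((sum_norm_sub_mean_sq_le X hY).trans (by
        refine (Finset.sum_le_card_nsmul _ _ (U ^ 2) fun a _ =>
          pow_le_pow_left₀ (norm_nonneg _) (hX a) 2).trans_eq ?_
        rw [nsmul_eq_mul, Finset.card_univ]))
      (fun a b => by
        rw [sub_sub_sub_cancel_right]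
        refine (norm_sub_le _ _).trans ?_
        linarith [hX a, hX b]) hθ0 s)
  refine h1.trans (ENNReal.ofReal_le_ofReal (le_of_eq ?_))
  rw [← Real.exp_sub]
  have h2 : θ * (√s * U) = q := by rw [hθ]; field_simp
  have h3 : θ * (√s * U) + s * (θ ^ 2 * U ^ 2 / 2) - θ * (√s * U * (1 + q)) =
      Real.log δ * (4 : ℕ) := by
    have h4 : (s : ℝ) * (θ ^ 2 * U ^ 2 / 2) = (θ * (√s * U)) ^ 2 / 2 := by
      rw [mul_pow θ, mul_pow (√(s : ℝ)), hrs2]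
      ring
    rw [h4, show θ * (√s * U * (1 + q)) = θ * (√s * U) * (1 + q) by ring, h2]
    have h5 : ℓ = -Real.log δ := by rw [hℓ, one_div, Real.log_inv]
    push_cast
    nlinarith
  rw [h3, Real.exp_mul, Real.exp_log hδ, Real.rpow_natCast]

/-- Concentration of the mean of a batch of symmetric operators. -/
theorem Sampling.uniformOn_opNorm_mean_sub_le (T : Sampling) {n m s : ℕ} (hn : 0 < n) (hm : 0 < m)
    (X : Fin m → Op n) (hsymm : ∀ a, SymmOp (X a)) {U h δ : ℝ} (hU : 0 < U)
    (hh : 0 < h) (hδ : 0 < δ) (hδ1 : δ < 1) (hX : ∀ a, ‖X a‖ ≤ U)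
    (hs : 5184 * U ^ 2 / h ^ 2 * Real.log (2 * (n : ℝ) / δ) ≤ (s : ℝ)) :
    uniformOn (T.batches s m)
      {S | h / 18 < ‖(s : ℝ)⁻¹ • ∑ j, X (S j) - (m : ℝ)⁻¹ • ∑ a, X a‖} ≤
      ENNReal.ofReal (δ ^ 4 / 8) := by
  have hn1 : (1 : ℝ) ≤ n := by exact_mod_cast hn
  set ℓ := Real.log (2 * (n : ℝ) / δ) with hℓ
  have hℓ0 : 0 < ℓ := Real.log_pos (by rw [lt_div_iff₀ hδ]; linarith)
  have hs0 : (0 : ℝ) < s := lt_of_lt_of_le (by positivity) hs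
  set μ : Op n := (m : ℝ)⁻¹ • ∑ a, X a with hμ
  have hY : ∑ a, (X a - μ) = 0 := sum_sub_mean hm X
  have hYs : ∀ a, SymmOp (X a - μ) := fun a =>
    (hsymm a).sub ((SymmOp.sum _ fun b _ => hsymm b).smul _)
  set t := h / 18 with ht
  have ht0 : 0 < t := by positivity
  -- The minimizer of `s * U ^ 2 * θ ^ 2 - s * t * θ`. Its minimum `-s * t ^ 2 / (4 * U ^ 2)` is at
  -- most `-4 * ℓ`, because `5184 = 4 * 4 * 18 ^ 2`.
  set θ := t / (2 * U ^ 2) with hθ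
  have hθ0 : 0 ≤ θ := by positivity
  have h1 := T.uniformOn_le (s := s) hm (convexOn_coshTrace θ) (fun a => X a - μ)
    (fun _ => SymmOp.sum _ fun j _ => hYs _) (fun _ => coshTrace_nonneg _ _)
    (E := {S | t < ‖(s : ℝ)⁻¹ • ∑ j, X (S j) - μ‖})
    (c := Real.exp (θ * (s * t)) / 2) (by positivity) (fun S hS =>
      SymmOp.exp_le_coshTrace (SymmOp.sum _ fun j _ => hYs _) θ (by positivity)
        (lt_norm_sum_sub (by exact_mod_cast hs0) X μ S hS))
    (sum_coshTrace_le hm _ hYs hY (D := 2 * U)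
      (fun a b => by
        rw [sub_sub_sub_cancel_right]
        refine (norm_sub_le _ _).trans ?_
        linarith [hX a, hX b]) hθ0 s)
  refine h1.trans (ENNReal.ofReal_le_ofReal ?_)
  have h2 : (s : ℝ) * (2 * U) ^ 2 / 4 * θ ^ 2 - θ * (s * t) ≤ -ℓ * (4 : ℕ) := by
    have h3 : (s : ℝ) * (2 * U) ^ 2 / 4 * θ ^ 2 - θ * (s * t) = -(s * (t ^ 2 / (4 * U ^ 2))) := by
      rw [hθ]
      field_simp
      ring
    rw [h3]
    have h4 := mul_le_mul_of_nonneg_right hs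
      (show 0 ≤ t ^ 2 / (4 * U ^ 2) by positivity)
    have h5 : 5184 * U ^ 2 / h ^ 2 * ℓ * (t ^ 2 / (4 * U ^ 2)) = 4 * ℓ := by
      rw [ht]
      field_simp
      norm_num
    push_cast
    linarith
  have h6 : (n : ℝ) * Real.exp (s * (2 * U) ^ 2 / 4 * θ ^ 2) / (Real.exp (θ * (s * t)) / 2) =
      2 * n * Real.exp (s * (2 * U) ^ 2 / 4 * θ ^ 2 - θ * (s * t)) := by
    rw [Real.exp_sub]
    field_simp
  rw [h6]
  have h7 : Real.exp (-ℓ * (4 : ℕ)) = (δ / (2 * n)) ^ 4 := by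
    rw [Real.exp_mul, Real.exp_neg, hℓ, Real.exp_log (by positivity), inv_div, Real.rpow_natCast]
  calc _ ≤ 2 * n * (δ / (2 * n)) ^ 4 := by
        rw [← h7]
        exact mul_le_mul_of_nonneg_left (Real.exp_le_exp.2 h2) (by positivity)
    _ = δ ^ 4 / 8 / (n : ℝ) ^ 3 := by
        field_simp
        norm_num
    _ ≤ δ ^ 4 / 8 := div_le_self (by positivity) (one_le_pow₀ hn1)

end Tails

/-! ### The conjugate gradient method -/

section ConjugateGradient

variable {n : ℕ}

/-- The states of the conjugate gradient method. -/
noncomputable def cgState (A : Op n) (g : Vec n) (j : ℕ) : CGState n :=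
  (cgStep A)^[j] { d := 0, r := g, p := -g }

theorem cgState_succ (A : Op n) (g : Vec n) (j : ℕ) :
    cgState A g (j + 1) = cgStep A (cgState A g j) := Function.iterate_succ_apply' _ _ _

/-- The residuals are orthogonal to the earlier directions, and the directions are conjugate. -/
structure CGInvariant (A : Op n) (g : Vec n) (j : ℕ) : Prop where
  residual : (cgState A g j).r = A (cgState A g j).d + g
  span : (cgState A g j).d ∈ Submodule.span ℝ {v | ∃ i < j, v = (cgState A g i).p}
  orth : ∀ i < j, ⟪(cgState A g j).r, (cgState A g i).p⟫ = 0
  conj : ∀ i < j, ⟪(cgState A g j).p, A (cgState A g i).p⟫ = 0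
  inner_dir : ⟪(cgState A g j).r, (cgState A g j).p⟫ = -‖(cgState A g j).r‖ ^ 2
  dir_eq_zero : (cgState A g j).r = 0 → (cgState A g j).p = 0
  residual_span : ∃ c : ℝ, ∃ i ≤ j, (cgState A g j).p = -(cgState A g j).r + c • (cgState A g i).p

/-- The step length makes the new residual orthogonal to the last direction, and conjugacy takes
care of the earlier ones. Residuals are combinations of directions, so they are mutually orthogonal;
since `A (p i)` is a multiple of `r (i + 1) - r i`, conjugacy of the new direction follows. Once the
residual is zero, the convention `0 / 0 = 0` freezes the state and the invariants persist. -/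
theorem cgInvariant {A : Op n} (hA : SymmOp A) (hpos : ∀ x, x ≠ 0 → 0 < ⟪x, A x⟫) (g : Vec n)
    (j : ℕ) : ∀ i ≤ j, CGInvariant A g i := by
  induction j with
  | zero =>
    intro i hi
    obtain rfl : i = 0 := by omega
    constructor <;> try simp [cgState]
  | succ j ih =>
    intro i hi
    rcases Nat.lt_or_ge i (j + 1) with h | h
    · exact ih i (by omega)
    obtain rfl : i = j + 1 := by omega
    have I := ih j le_rfl
    set r := fun i => (cgState A g i).r with hr
    set p := fun i => (cgState A g i).p with hp
    set d := fun i => (cgState A g i).d with hd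
    set a : ℕ → ℝ := fun i => ‖r i‖ ^ 2 / ⟪p i, A (p i)⟫ with ha
    have hrs : ∀ i, r (i + 1) = r i + a i • A (p i) := fun i => by
      simp only [hr, cgState_succ, cgStep, ha, hp]
    have hds : ∀ i, d (i + 1) = d i + a i • p i := fun i => by
      simp only [hr, cgState_succ, cgStep, ha, hp, hd]
    have hps : ∀ i, p (i + 1) = -r (i + 1) + (‖r (i + 1)‖ ^ 2 / ‖r i‖ ^ 2) • p i := fun i => by
      simp only [hr, cgState_succ, cgStep, hp]
    have hp0 : ∀ i ≤ j, p i = 0 → r i = 0 := fun i hi h0 => by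
      have h1 := (ih i hi).inner_dir
      change ⟪r i, p i⟫ = -‖r i‖ ^ 2 at h1
      rw [h0, inner_zero_right] at h1
      have : ‖r i‖ = 0 := by nlinarith
      exact norm_eq_zero.1 this
    have haA : ∀ i ≤ j, a i * ⟪p i, A (p i)⟫ = ‖r i‖ ^ 2 := fun i hi => by
      by_cases h0 : p i = 0
      · simp [h0, hp0 i hi h0]
      · exact div_mul_cancel₀ _ (hpos _ h0).ne'
    have ha0 : ∀ i ≤ j, a i = 0 → p i = 0 := fun i hi h0 => by
      have h1 := haA i hi
      rw [h0, zero_mul] at h1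
      have : ‖r i‖ = 0 := by nlinarith
      exact (ih i hi).dir_eq_zero (norm_eq_zero.1 this)
    have horth : ∀ i < j + 1, ⟪r (j + 1), p i⟫ = 0 := fun i hi => by
      rw [hrs, inner_add_left, real_inner_smul_left]
      rcases Nat.lt_or_ge i j with h | h
      · have h1 : ⟪r j, p i⟫ = 0 := I.orth i h
        have h2 : ⟪p j, A (p i)⟫ = 0 := I.conj i h
        rw [h1, hA, h2, mul_zero, add_zero]
      · obtain rfl : i = j := by omega
        have h1 : ⟪r i, p i⟫ = -‖r i‖ ^ 2 := I.inner_dir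
        rw [h1, hA, haA i le_rfl, neg_add_cancel]
    have horthr : ∀ i < j + 1, ⟪r (j + 1), r i⟫ = 0 := fun i hi => by
      obtain ⟨c, k, hk, hpk⟩ := (ih i (by omega)).residual_span
      change p i = -r i + c • p k at hpk
      have h1 : r i = c • p k - p i := by rw [hpk]; abel
      rw [h1, inner_sub_right, inner_smul_right, horth k (by omega), horth i hi, mul_zero, sub_zero]
    refine ⟨?_, ?_, horth, ?_, ?_, ?_, ?_⟩
    · change r (j + 1) = A (d (j + 1)) + g
      have h1 : r j = A (d j) + g := I.residual
      rw [hrs, hds, map_add, map_smul, h1]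
      abel
    · change d (j + 1) ∈ _
      rw [hds]
      refine add_mem (Submodule.span_mono ?_ I.span) (Submodule.smul_mem _ _ ?_)
      · rintro v ⟨i, hi, rfl⟩
        exact ⟨i, by omega, rfl⟩
      · exact Submodule.subset_span ⟨j, by omega, rfl⟩
    · intro i hi
      change ⟪p (j + 1), A (p i)⟫ = 0
      by_cases hz : a i = 0
      · rw [ha0 i (by omega) hz, map_zero, inner_zero_right]
      have h1 : A (p i) = (a i)⁻¹ • (r (i + 1) - r i) := by
        rw [hrs, add_sub_cancel_left, inv_smul_smul₀ hz]
      rw [hps, inner_add_left, inner_neg_left, real_inner_smul_left]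
      rcases Nat.lt_or_ge i j with h | h
      · have h2 : ⟪p j, A (p i)⟫ = 0 := I.conj i h
        rw [h2, h1, inner_smul_right, inner_sub_right, horthr i hi, horthr (i + 1) (by omega)]
        simp
      · obtain rfl : i = j := by omega
        have h2 : ⟪r (i + 1), A (p i)⟫ = (a i)⁻¹ * ‖r (i + 1)‖ ^ 2 := by
          rw [h1, inner_smul_right, inner_sub_right, horthr i hi, real_inner_self_eq_norm_sq,
            sub_zero]
        have hri : ‖r i‖ ^ 2 ≠ 0 := fun h0 => hz (by simp [ha, h0])
        have h3 := haA i le_rfl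
        rw [h2, ← h3]
        have h4 : ⟪p i, A (p i)⟫ ≠ 0 := fun h0 => hri (by rw [← h3, h0, mul_zero])
        field_simp
        ring
    · change ⟪r (j + 1), p (j + 1)⟫ = -‖r (j + 1)‖ ^ 2
      rw [hps, inner_add_right, inner_neg_right, inner_smul_right, horth j (by omega),
        real_inner_self_eq_norm_sq, mul_zero, add_zero]
    · change r (j + 1) = 0 → p (j + 1) = 0
      intro h0
      rw [hps, h0]
      simp
    · exact ⟨_, j, by omega, hps j⟩

/-- The residual at an iterate of the conjugate gradient method is orthogonal to the iterate. -/
theorem inner_cgIterate_residual {A : Op n} (hA : SymmOp A) (hpos : ∀ x, x ≠ 0 → 0 < ⟪x, A x⟫)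
    (g : Vec n) (j : ℕ) : ⟪A (cgIterate A g j) + g, cgIterate A g j⟫ = 0 := by
  have I := cgInvariant hA hpos g j j le_rfl
  have h1 : cgIterate A g j = (cgState A g j).d := rfl
  rw [h1, ← I.residual]
  have h2 : ∀ v ∈ Submodule.span ℝ {v | ∃ i < j, v = (cgState A g i).p},
      ⟪(cgState A g j).r, v⟫ = 0 := by
    intro v hv
    induction hv using Submodule.span_induction with
    | mem v hv =>
      obtain ⟨i, hi, rfl⟩ := hv
      exact I.orth i hi
    | zero => exact inner_zero_right _
    | add x y _ _ hx hy => rw [inner_add_right, hx, hy, add_zero]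
    | smul a x _ hx => rw [inner_smul_right, hx, mul_zero]
  exact h2 _ I.span

end ConjugateGradient

/-! ### Derivatives and Taylor bounds -/

section Calculus

variable {n : ℕ} {F : Vec n → ℝ} {B : Set (Vec n)}

theorem TwiceDifferentiableOn.hasGradientAt (hF : TwiceDifferentiableOn F B) (hB : IsOpen B)
    {x : Vec n} (hx : x ∈ B) : HasGradientAt F (gradient F x) x :=
  ((hF.1 x hx).differentiableAt (hB.mem_nhds hx)).hasGradientAt

theorem TwiceDifferentiableOn.hasFDerivAt_gradient (hF : TwiceDifferentiableOn F B)
    (hB : IsOpen B) {x : Vec n} (hx : x ∈ B) : HasFDerivAt (gradient F) (hess F x) x :=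
  ((hF.2 x hx).differentiableAt (hB.mem_nhds hx)).hasFDerivAt

/-- Symmetry of second derivatives needs only a derivative near `x` that is differentiable at `x`;
continuity of the Hessian plays no role. -/
theorem TwiceDifferentiableOn.symmOp_hess (hF : TwiceDifferentiableOn F B) (hB : IsOpen B)
    {x : Vec n} (hx : x ∈ B) : SymmOp (hess F x) := fun u v => by
  have h1 := second_derivative_symmetric_of_eventually (f := F)
    (f' := fun y => innerSL ℝ (gradient F y)) (f'' := (innerSL ℝ).comp (hess F x)) (x := x)
    (Filter.eventually_of_mem (hB.mem_nhds hx) fun y hy => (hF.hasGradientAt hB hy).hasFDerivAt)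
    ((innerSL ℝ).hasFDerivAt.comp x (hF.hasFDerivAt_gradient hB hx)) u v
  simp only [ContinuousLinearMap.comp_apply, innerSL_apply_apply] at h1
  rw [h1, real_inner_comm]

theorem hasGradientAt_finiteSum {m : ℕ} {f : Fin m → Vec n → ℝ}
    (hf : ∀ i, TwiceDifferentiableOn (f i) B) (hB : IsOpen B) {x : Vec n} (hx : x ∈ B) :
    HasGradientAt (finiteSum f) ((m : ℝ)⁻¹ • ∑ i, gradient (f i) x) x := by
  have h1 : HasFDerivAt (fun y => (m : ℝ)⁻¹ * ∑ i, f i y)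
      ((m : ℝ)⁻¹ • ∑ i, InnerProductSpace.toDual ℝ (Vec n) (gradient (f i) x)) x :=
    (HasFDerivAt.fun_sum fun i _ => ((hf i).hasGradientAt hB hx).hasFDerivAt).const_mul _
  rw [hasGradientAt_iff_hasFDerivAt]
  have h2 : InnerProductSpace.toDual ℝ (Vec n) ((m : ℝ)⁻¹ • ∑ i, gradient (f i) x) =
      (m : ℝ)⁻¹ • ∑ i, InnerProductSpace.toDual ℝ (Vec n) (gradient (f i) x) := by
    simp [map_sum]
  rw [h2]
  exact h1

theorem gradient_finiteSum {m : ℕ} {f : Fin m → Vec n → ℝ}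
    (hf : ∀ i, TwiceDifferentiableOn (f i) B) (hB : IsOpen B) {x : Vec n} (hx : x ∈ B) :
    gradient (finiteSum f) x = (m : ℝ)⁻¹ • ∑ i, gradient (f i) x :=
  (hasGradientAt_finiteSum hf hB hx).gradient

theorem hasFDerivAt_gradient_finiteSum {m : ℕ} {f : Fin m → Vec n → ℝ}
    (hf : ∀ i, TwiceDifferentiableOn (f i) B) (hB : IsOpen B) {x : Vec n} (hx : x ∈ B) :
    HasFDerivAt (gradient (finiteSum f)) ((m : ℝ)⁻¹ • ∑ i, hess (f i) x) x := by
  have h1 : HasFDerivAt (fun y => (m : ℝ)⁻¹ • ∑ i, gradient (f i) y)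
      ((m : ℝ)⁻¹ • ∑ i, hess (f i) x) x :=
    (HasFDerivAt.fun_sum fun i _ => (hf i).hasFDerivAt_gradient hB hx).fun_const_smul _
  exact h1.congr_of_eventuallyEq
    (Filter.eventually_of_mem (hB.mem_nhds hx) fun y hy => gradient_finiteSum hf hB hy)

theorem hess_finiteSum {m : ℕ} {f : Fin m → Vec n → ℝ}
    (hf : ∀ i, TwiceDifferentiableOn (f i) B) (hB : IsOpen B) {x : Vec n} (hx : x ∈ B) :
    hess (finiteSum f) x = (m : ℝ)⁻¹ • ∑ i, hess (f i) x :=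
  (hasFDerivAt_gradient_finiteSum hf hB hx).fderiv

theorem twiceDifferentiableOn_finiteSum {m : ℕ} {f : Fin m → Vec n → ℝ}
    (hf : ∀ i, TwiceDifferentiableOn (f i) B) (hB : IsOpen B) :
    TwiceDifferentiableOn (finiteSum f) B :=
  ⟨fun _ hx => (hasGradientAt_finiteSum hf hB hx).hasFDerivAt.differentiableAt.differentiableWithinAt,
    fun _ hx =>
      (hasFDerivAt_gradient_finiteSum hf hB hx).differentiableAt.differentiableWithinAt⟩

theorem add_smul_mem_of_segment_subset {x v : Vec n} (hseg : segment ℝ x (x + v) ⊆ B) {t : ℝ}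
    (ht : t ∈ Set.Icc (0 : ℝ) 1) : x + t • v ∈ B :=
  hseg (by rw [segment_eq_image']; exact ⟨t, ht, by simp⟩)

theorem abs_inner_sub_le {H H' : Op n} {c : ℝ} (h : ‖H - H'‖ ≤ c) (v : Vec n) :
    |⟪v, H v⟫ - ⟪v, H' v⟫| ≤ c * ‖v‖ ^ 2 := by
  rw [← inner_sub_right, ← sub_apply]
  calc _ ≤ ‖v‖ * ‖(H - H') v‖ := abs_real_inner_le_norm _ _
    _ ≤ ‖v‖ * (c * ‖v‖) := mul_le_mul_of_nonneg_left
        (((H - H').le_opNorm v).trans (mul_le_mul_of_nonneg_right h (norm_nonneg _)))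
        (norm_nonneg _)
    _ = _ := by ring

/-- The cubic upper model of a function with Lipschitz continuous Hessian. -/
theorem TwiceDifferentiableOn.le_cubic_model (hF : TwiceDifferentiableOn F B) (hB : IsOpen B)
    {L : ℝ} (hL : ∀ x ∈ B, ∀ y ∈ B, ‖hess F x - hess F y‖ ≤ L * ‖x - y‖) {x v : Vec n}
    (hseg : segment ℝ x (x + v) ⊆ B) :
    F (x + v) ≤ F x + ⟪gradient F x, v⟫ + ⟪v, hess F x v⟫ / 2 + L / 6 * ‖v‖ ^ 3 := by
  have hmem : ∀ t ∈ Set.Icc (0 : ℝ) 1, x + t • v ∈ B := fun t ht =>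
    add_smul_mem_of_segment_subset hseg ht
  have hline : ∀ t : ℝ, HasDerivAt (fun t : ℝ => x + t • v) v t := fun t => by
    simpa using ((hasDerivAt_id t).smul_const v).const_add x
  have hphi : ∀ t ∈ Set.Icc (0 : ℝ) 1,
      HasDerivAt (fun t : ℝ => F (x + t • v)) ⟪gradient F (x + t • v), v⟫ t := fun t ht => by
    have h1 : HasFDerivAt F (innerSL ℝ (gradient F (x + t • v))) (x + t • v) :=
      (hF.hasGradientAt hB (hmem t ht)).hasFDerivAt
    exact h1.comp_hasDerivAt t (hline t)
  have ha : ∀ t ∈ Set.Icc (0 : ℝ) 1, HasDerivAt (fun t : ℝ => ⟪gradient F (x + t • v), v⟫)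
      ⟪v, hess F (x + t • v) v⟫ t := fun t ht => by
    have h1 := ((hF.hasFDerivAt_gradient hB (hmem t ht)).comp_hasDerivAt t (hline t)).inner ℝ
      (hasDerivAt_const t v)
    simpa [real_inner_comm] using h1
  have hbound : ∀ t ∈ Set.Icc (0 : ℝ) 1,
      ⟪v, hess F (x + t • v) v⟫ ≤ ⟪v, hess F x v⟫ + L * t * ‖v‖ ^ 3 := fun t ht => by
    have h0 : x ∈ B := by simpa using hmem 0 (by simp)
    have h1 := hL _ (hmem t ht) x h0
    rw [add_sub_cancel_left, norm_smul, Real.norm_of_nonneg ht.1] at h1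
    have h2 := (abs_le.1 (abs_inner_sub_le h1 v)).2
    linarith
  have h01 : interior (Set.Icc (0 : ℝ) 1) ⊆ Set.Icc 0 1 := interior_subset
  -- The Hessian bound is integrated twice along the segment, each time as monotonicity of the
  -- difference from the polynomial model.
  have hpsi : ∀ t ∈ Set.Icc (0 : ℝ) 1, ⟪gradient F (x + t • v), v⟫ ≤
      ⟪gradient F x, v⟫ + t * ⟪v, hess F x v⟫ + L / 2 * t ^ 2 * ‖v‖ ^ 3 := fun t ht => by
    have hd : ∀ t ∈ Set.Icc (0 : ℝ) 1, HasDerivAt (fun t : ℝ => ⟪gradient F (x + t • v), v⟫ -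
        (t * ⟪v, hess F x v⟫ + L / 2 * ‖v‖ ^ 3 * t ^ 2))
        (⟪v, hess F (x + t • v) v⟫ -
          (1 * ⟪v, hess F x v⟫ + L / 2 * ‖v‖ ^ 3 * (2 * t))) t := fun t ht => by
      refine (ha t ht).sub (((hasDerivAt_id t).mul_const _).add ?_)
      simpa using (hasDerivAt_pow 2 t).const_mul (L / 2 * ‖v‖ ^ 3)
    have hanti := antitoneOn_of_deriv_nonpos (convex_Icc (0 : ℝ) 1)
      (fun t ht => (hd t ht).continuousAt.continuousWithinAt)
      (fun t ht => (hd t (h01 ht)).differentiableAt.differentiableWithinAt) fun t ht => by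
        rw [(hd t (h01 ht)).deriv]
        linarith [hbound t (h01 ht)]
    have := hanti (Set.left_mem_Icc.2 zero_le_one) ht ht.1
    simp only [zero_smul, add_zero] at this
    linarith
  have hd : ∀ t ∈ Set.Icc (0 : ℝ) 1, HasDerivAt (fun t : ℝ => F (x + t • v) -
      (t * ⟪gradient F x, v⟫ + ⟪v, hess F x v⟫ / 2 * t ^ 2 + L / 6 * ‖v‖ ^ 3 * t ^ 3))
      (⟪gradient F (x + t • v), v⟫ - (1 * ⟪gradient F x, v⟫ +
        ⟪v, hess F x v⟫ / 2 * (2 * t) + L / 6 * ‖v‖ ^ 3 * (3 * t ^ 2))) t := fun t ht => by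
    refine (hphi t ht).sub ((((hasDerivAt_id t).mul_const _).add ?_).add ?_)
    · simpa using (hasDerivAt_pow 2 t).const_mul (⟪v, hess F x v⟫ / 2)
    · simpa using (hasDerivAt_pow 3 t).const_mul (L / 6 * ‖v‖ ^ 3)
  have hanti := antitoneOn_of_deriv_nonpos (convex_Icc (0 : ℝ) 1)
    (fun t ht => (hd t ht).continuousAt.continuousWithinAt)
    (fun t ht => (hd t (h01 ht)).differentiableAt.differentiableWithinAt) fun t ht => by
      rw [(hd t (h01 ht)).deriv]
      linarith [hpsi t (h01 ht)]
  have := hanti (Set.left_mem_Icc.2 zero_le_one) (Set.right_mem_Icc.2 zero_le_one) zero_le_one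
  simp only [zero_smul, one_smul, add_zero] at this
  linarith

/-- The mean value inequality for `z ↦ gradient F z - hess F x z`; it loses the sharp factor `1 /
2`, which only affects the final constant. -/
theorem TwiceDifferentiableOn.norm_gradient_sub_le (hF : TwiceDifferentiableOn F B)
    (hB : IsOpen B) {L : ℝ} (hL0 : 0 ≤ L)
    (hL : ∀ x ∈ B, ∀ y ∈ B, ‖hess F x - hess F y‖ ≤ L * ‖x - y‖) {x v : Vec n}
    (hseg : segment ℝ x (x + v) ⊆ B) :
    ‖gradient F (x + v) - gradient F x - hess F x v‖ ≤ L * ‖v‖ ^ 2 := by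
  have h1 := (convex_segment (𝕜 := ℝ) x (x + v)).norm_image_sub_le_of_norm_hasFDerivWithin_le
    (f := fun z => gradient F z - hess F x z) (f' := fun z => hess F z - hess F x)
    (C := L * ‖v‖) (x := x) (y := x + v)
    (fun z hz => ((hF.hasFDerivAt_gradient hB (hseg hz)).sub
      (hess F x).hasFDerivAt).hasFDerivWithinAt)
    (fun z hz => (hL z (hseg hz) x (hseg (left_mem_segment ℝ _ _))).trans
      (mul_le_mul_of_nonneg_left (by
        rw [segment_eq_image'] at hz
        obtain ⟨t, ht, rfl⟩ := hz
        simp only [add_sub_cancel_left, norm_smul, Real.norm_of_nonneg ht.1]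
        exact mul_le_of_le_one_left (norm_nonneg _) ht.2) hL0))
    (left_mem_segment ℝ _ _) (right_mem_segment ℝ _ _)
  rw [add_sub_cancel_left] at h1
  calc _ = ‖gradient F (x + v) - hess F x (x + v) - (gradient F x - hess F x x)‖ := by
        rw [map_add]
        congr 1
        abel
    _ ≤ _ := h1
    _ = _ := by ring

end Calculus

/-! ### One iteration with accurate derivatives -/

section OneIteration

variable {n : ℕ} {F : Vec n → ℝ} {B : Set (Vec n)} {L ε η μ : ℝ} {x g p d : Vec n} {Q : Op n}

theorem inner_gradient_le {G g : Vec n} {c : ℝ} (hg : ‖g - G‖ ≤ c) (v : Vec n) :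
    ⟪G, v⟫ ≤ ⟪g, v⟫ + c * ‖v‖ := by
  have h1 := neg_le_of_abs_le (abs_real_inner_le_norm (g - G) v)
  rw [inner_sub_left] at h1
  have h2 := mul_le_mul_of_nonneg_right hg (norm_nonneg v)
  linarith

/-- With `L = l ^ 2` and `ε = e ^ 2`, all fractional powers become monomials. -/
theorem exists_sqrt_parametrization {L ε : ℝ} (hL : 0 < L) (hε : 0 < ε) :
    ∃ l e : ℝ, 0 < l ∧ 0 < e ∧ √L = l ∧ √ε = e ∧ L = l ^ 2 ∧ ε = e ^ 2 ∧ √(L * ε) = l * e ∧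
      ε ^ (3 / 2 : ℝ) = e ^ 3 := by
  refine ⟨√L, √ε, Real.sqrt_pos.2 hL, Real.sqrt_pos.2 hε, rfl, rfl, (Real.sq_sqrt hL.le).symm,
    (Real.sq_sqrt hε.le).symm, Real.sqrt_mul hL.le ε, ?_⟩
  rw [Real.sqrt_eq_rpow, ← Real.rpow_natCast, ← Real.rpow_mul hε.le]
  norm_num

theorem decrease_negativeCurvature (hF : TwiceDifferentiableOn F B) (hB : IsOpen B)
    (hL0 : 0 < L) (hε : 0 < ε)
    (hL : ∀ x ∈ B, ∀ y ∈ B, ‖hess F x - hess F y‖ ≤ L * ‖x - y‖)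
    (hg : ‖g - gradient F x‖ ≤ ε / 3) (hQ : ‖Q - hess F x‖ ≤ √(L * ε) / 18) (hp : ‖p‖ = 1)
    {σ : ℝ} (hcurv : ⟪p, Q p⟫ < -√(L * ε)) (hσ : σ = 1 ∨ σ = -1)
    (hsign : σ * ⟪g, p⟫ = |⟪g, p⟫|)
    (hseg : segment ℝ x (x + (17 / (12 * L) * √(L * ε)) • (-(σ • p))) ⊆ B) :
    F (x + (17 / (12 * L) * √(L * ε)) • (-(σ • p))) ≤ F x - cNC L * ε ^ (3 / 2 : ℝ) := by
  have h1 := hF.le_cubic_model hB hL hseg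
  refine h1.trans ?_
  obtain ⟨l, e, hl, he, hsl, -, hLl, hεe, hh, hpow⟩ := exists_sqrt_parametrization hL0 hε
  have hσ2 : σ ^ 2 = 1 := by rcases hσ with rfl | rfl <;> norm_num
  have hσn : ‖σ • p‖ = 1 := by
    rw [norm_smul, hp, mul_one, Real.norm_eq_abs]
    rcases hσ with rfl | rfl <;> norm_num
  rw [hpow, cNC, hsl]
  rw [hh] at hQ hcurv ⊢
  set α := 17 / (12 * L) * (l * e) with hα
  have hα' : α = 17 / 12 * (e / l) := by
    rw [hα, hLl]
    field_simp
  have hα0 : 0 < α := by rw [hα']; positivity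
  have h2 := inner_gradient_le hg (-(σ • p))
  rw [norm_neg, hσn, inner_neg_right g, real_inner_smul_right, hsign, mul_one] at h2
  have h3 : ⟪gradient F x, -(σ • p)⟫ ≤ e ^ 2 / 3 := by
    have := abs_nonneg ⟪g, p⟫
    rw [hεe] at h2
    linarith
  have h4 := neg_le_of_abs_le (abs_inner_sub_le hQ p)
  rw [hp] at h4
  have h5 : ⟪p, hess F x p⟫ ≤ -(17 / 18 * (l * e)) := by linarith
  have h6 : ⟪α • -(σ • p), hess F x (α • -(σ • p))⟫ = α ^ 2 * ⟪p, hess F x p⟫ := by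
    simp only [map_smul, map_neg, inner_neg_left, inner_neg_right, real_inner_smul_left,
      real_inner_smul_right, smul_neg, neg_neg]
    calc _ = α ^ 2 * σ ^ 2 * ⟪p, hess F x p⟫ := by ring
      _ = _ := by rw [hσ2, mul_one]
  have h7 : ‖α • -(σ • p)‖ = α := by
    rw [norm_smul, norm_neg, hσn, mul_one, Real.norm_of_nonneg hα0.le]
  rw [h6, h7, real_inner_smul_right]
  have h8 := mul_le_mul_of_nonneg_left h3 hα0.le
  have h9 := mul_le_mul_of_nonneg_left h5 (sq_nonneg α)
  -- In units of `e ^ 3 / l` the terms are `4896 / 10368`, `-9826 / 10368` and `4913 / 10368`. Their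
  -- sum is exactly the constant of `cNC`.
  have h10 : α * (e ^ 2 / 3) + α ^ 2 * -(17 / 18 * (l * e)) / 2 + L / 6 * α ^ 3 =
      -(17 / (10368 * l) * e ^ 3) := by
    rw [hα', hLl]
    field_simp
    norm_num
  linarith

/-- The regularized approximate Hessian is uniformly positive definite. -/
theorem regularized_coercive {h : ℝ} (hQs : SymmOp Q)
    (hacc : ⟪p, Q p⟫ - lamMin Q ≤ h / 2) (hcurv : -h ≤ ⟪p, Q p⟫) (v : Vec n) :
    h / 2 * ‖v‖ ^ 2 ≤ ⟪v, (Q + (2 * h) • ContinuousLinearMap.id ℝ (Vec n)) v⟫ := by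
  have h1 := hQs.lamMin_mul_le v
  have h2 : ⟪v, (Q + (2 * h) • ContinuousLinearMap.id ℝ (Vec n)) v⟫ =
      ⟪v, Q v⟫ + 2 * h * ‖v‖ ^ 2 := by
    simp [inner_add_right, real_inner_smul_right]
  rw [h2]
  have h3 := mul_le_mul_of_nonneg_right (show -(3 / 2 * h) ≤ lamMin Q by linarith)
    (sq_nonneg ‖v‖)
  linarith

theorem decrease_newton (hF : TwiceDifferentiableOn F B) (hB : IsOpen B)
    (hL0 : 0 < L) (hε : 0 < ε) (hη : 0 < η)
    (hL : ∀ x ∈ B, ∀ y ∈ B, ‖hess F x - hess F y‖ ≤ L * ‖x - y‖)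
    (hg : ‖g - gradient F x‖ ≤ ε / 3) (hQ : ‖Q - hess F x‖ ≤ √(L * ε) / 18) (hQs : SymmOp Q)
    (hacc : ⟪p, Q p⟫ - lamMin Q ≤ √(L * ε) / 2) (hcurv : -√(L * ε) ≤ ⟪p, Q p⟫) {j : ℕ}
    (hd : d = cgIterate (Q + (2 * √(L * ε)) • ContinuousLinearMap.id ℝ (Vec n)) g j)
    (hlong : 2 * ε / √(L * ε) < ‖d‖)
    (hseg : segment ℝ x (x + (√2 / (√(3 * (L + η)) * ‖d‖) * √ε) • d) ⊆ B) :
    F (x + (√2 / (√(3 * (L + η)) * ‖d‖) * √ε) • d) ≤ F x - cSOL L η * ε ^ (3 / 2 : ℝ) := by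
  have h1 := hF.le_cubic_model hB hL hseg
  refine h1.trans ?_
  obtain ⟨l, e, hl, he, -, hse, hLl, hεe, hh, hpow⟩ := exists_sqrt_parametrization hL0 hε
  have hcoer := regularized_coercive hQs hacc hcurv
  rw [hh] at hQ hcurv hd hlong hcoer
  have hh0 : 0 < l * e := by positivity
  set h := l * e
  set A := Q + (2 * h) • ContinuousLinearMap.id ℝ (Vec n) with hA
  have hAs : SymmOp A := hQs.add (SymmOp.id.smul _)
  have hres := inner_cgIterate_residual hAs (fun v hv => lt_of_lt_of_le
    (mul_pos (half_pos hh0) (pow_pos (norm_pos_iff.2 hv) 2)) (hcoer v)) g j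
  rw [← hd, inner_add_left, real_inner_comm] at hres
  have hN0 : 0 < ‖d‖ := lt_of_le_of_lt (by positivity) hlong
  set N := ‖d‖
  have hlong' : 2 * ε < h * N := by
    rw [div_lt_iff₀ hh0] at hlong
    linarith
  set r := √(3 * (L + η)) with hr
  have hr0 : 0 < r := Real.sqrt_pos.2 (by positivity)
  have hr2 : r ^ 2 = 3 * (L + η) := Real.sq_sqrt (by positivity)
  rw [hse, hpow]
  -- The step has length `α * N = β` independent of `d`, with `β ^ 2 = 2 * ε / (3 * (L + η))`.
  set α := √2 / (r * N) * e with hα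
  have hα0 : 0 < α := by positivity
  set β := √2 * e / r with hβ
  have hβ0 : 0 < β := by positivity
  have hαβ : α * N = β := by
    rw [hα, hβ]
    field_simp
  have hβ2 : β ^ 2 * (3 * (L + η)) = 2 * ε := by
    rw [hβ, ← hr2, hεe, div_pow, mul_pow, Real.sq_sqrt (by norm_num : (0 : ℝ) ≤ 2)]
    field_simp
  have hLβ : L * β ^ 2 ≤ 2 / 3 * ε := by
    have : 0 ≤ η * β ^ 2 := by positivity
    linarith
  -- A long direction means a short step factor: `2 * ε < h * N` gives `2 * α * ε ≤ h * β`, and `h *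
  -- β ≤ ε`.
  have hα1 : α ≤ 1 := by
    have h2 : α * (2 * ε) ≤ h * β := by
      rw [← hαβ]
      have := mul_le_mul_of_nonneg_left hlong'.le hα0.le
      linarith
    have h3 : h * β ≤ ε := by
      refine le_of_sq_le_sq ?_ hε.le
      rw [mul_pow, show h ^ 2 = L * ε by simp only [h]; rw [hLl, hεe]; ring]
      have := mul_le_mul_of_nonneg_right hLβ hε.le
      have h4 := sq_nonneg ε
      linarith
    by_contra! hcon
    have := mul_lt_mul_of_pos_right hcon hε
    linarith
  have h2 := inner_gradient_le hg d
  have h3 := neg_le_of_abs_le (abs_inner_sub_le hQ d)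
  have h4 : ⟪d, A d⟫ = ⟪d, Q d⟫ + 2 * h * N ^ 2 := by
    simp [hA, inner_add_right, real_inner_smul_right, N]
  have h5 := hcoer d
  have h6 : ⟪α • d, hess F x (α • d)⟫ = α ^ 2 * ⟪d, hess F x d⟫ := by
    simp only [map_smul, real_inner_smul_left, real_inner_smul_right]
    ring
  have h7 : ‖α • d‖ = β := by rw [norm_smul, Real.norm_of_nonneg hα0.le, ← hαβ]
  rw [h6, h7, real_inner_smul_right]
  have h8 : ⟪gradient F x, d⟫ ≤ -⟪d, A d⟫ + ε / 3 * N := by linarith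
  have h9 : ⟪d, hess F x d⟫ ≤ ⟪d, A d⟫ - 35 / 18 * h * N ^ 2 := by linarith
  have h10 : α * ⟪gradient F x, d⟫ + α ^ 2 * ⟪d, hess F x d⟫ / 2 ≤
      -(α * (h / 2 * N ^ 2)) + α * (ε / 3 * N) := by
    have e1 := mul_le_mul_of_nonneg_left h8 hα0.le
    have e2 := mul_le_mul_of_nonneg_left h9 (sq_nonneg α)
    have e3 := mul_le_mul_of_nonneg_left h5 (show 0 ≤ α - α ^ 2 / 2 by nlinarith)
    have e4 : 0 ≤ α ^ 2 * (h * N ^ 2) := by positivity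
    linarith
  -- After factoring out `β`, the bounds are `-ε` from curvature, `ε / 3` from the gradient error
  -- and `ε / 9` from the cubic term.
  have h11 : -(α * (h / 2 * N ^ 2)) + α * (ε / 3 * N) + L / 6 * β ^ 3 ≤ -(5 / 9 * (β * ε)) := by
    have e1 : -(α * (h / 2 * N ^ 2)) + α * (ε / 3 * N) + L / 6 * β ^ 3 =
        β * (-(h * N / 2) + ε / 3 + L * β ^ 2 / 6) := by
      rw [← hαβ]
      ring
    have e2 : -(5 / 9 * (β * ε)) = β * (-(5 / 9 * ε)) := by ring
    rw [e1, e2]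
    exact mul_le_mul_of_nonneg_left (by linarith) hβ0.le
  have h12 : cSOL L η * e ^ 3 ≤ 5 / 9 * (β * ε) := by
    have hLη : 0 < L + η := by positivity
    have e1 : (L + η) ^ (3 / 2 : ℝ) = (L + η) * √(L + η) := by
      rw [Real.sqrt_eq_rpow, show (3 / 2 : ℝ) = 1 + 1 / 2 by norm_num, Real.rpow_add hLη,
        Real.rpow_one]
    have e2 : r = √3 * √(L + η) := Real.sqrt_mul (by norm_num) _
    have e3 : cSOL L η * e ^ 3 = η / (L + η) / 9 * (β * ε) := by
      rw [cSOL, e1, hβ, e2, hεe]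
      have := Real.sqrt_pos.2 hLη
      field_simp
    have e4 : η / (L + η) ≤ 1 := (div_le_one hLη).2 (by linarith)
    rw [e3]
    exact mul_le_mul_of_nonneg_right (by linarith) (by positivity)
  linarith

/-- The eigenvector test bounds `lamMin Q` below by `-3 / 2 * h`; passing from `Q` to `H` costs at
most `c`. -/
theorem curvature_bound_of_accurate (hn : 0 < n) {h c : ℝ} {H : Op n} (hQs : SymmOp Q)
    (hHs : SymmOp H) (hQ : ‖Q - H‖ ≤ c) (hacc : ⟪p, Q p⟫ - lamMin Q ≤ h / 2)
    (hcurv : -h ≤ ⟪p, Q p⟫) : -(3 / 2 * h + c) ≤ lamMin H := by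
  refine hHs.le_lamMin hn fun v => ?_
  have h1 := hQs.lamMin_mul_le v
  have h2 := le_of_abs_le (abs_inner_sub_le hQ v)
  have h3 := mul_le_mul_of_nonneg_right (show -(3 / 2 * h) ≤ lamMin Q by linarith)
    (sq_nonneg ‖v‖)
  linarith

theorem stationary_of_short_newton (hn : 0 < n) (hF : TwiceDifferentiableOn F B) (hB : IsOpen B)
    (hL0 : 0 < L) (hε : 0 < ε) (hμ : 0 < μ)
    (hL : ∀ x ∈ B, ∀ y ∈ B, ‖hess F x - hess F y‖ ≤ L * ‖x - y‖)
    (hg : ‖g - gradient F x‖ ≤ ε / 3) (hQ : ‖Q - hess F x‖ ≤ √(L * ε) / 18) (hQs : SymmOp Q)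
    (hacc : ⟪p, Q p⟫ - lamMin Q ≤ √(L * ε) / 2) (hcurv : -√(L * ε) ≤ ⟪p, Q p⟫)
    (hres : ‖(Q + (2 * √(L * ε)) • ContinuousLinearMap.id ℝ (Vec n)) d + g‖ ≤
      μ * √(L * ε) * ‖d‖)
    (hshort : ‖d‖ ≤ 2 * ε / √(L * ε)) (hseg : segment ℝ x (x + d) ⊆ B) :
    ‖gradient F (x + d)‖ ≤ (2 * μ + 20) * ε ∧
      -((2 * μ + 20) * √(L * ε)) ≤ lamMin (hess F (x + d)) := by
  have hx : x ∈ B := hseg (left_mem_segment ℝ _ _)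
  have hy : x + d ∈ B := hseg (right_mem_segment ℝ _ _)
  have hLε : √(L * ε) ^ 2 = L * ε := Real.sq_sqrt (by positivity)
  have hh0 : 0 < √(L * ε) := Real.sqrt_pos.2 (by positivity)
  set h := √(L * ε)
  have hN : h * ‖d‖ ≤ 2 * ε := by
    rw [le_div_iff₀ hh0] at hshort
    linarith
  have hLN : L * ‖d‖ ≤ 2 * h := by
    refine le_of_mul_le_mul_right ?_ hε
    have := mul_le_mul_of_nonneg_left hN hh0.le
    calc L * ‖d‖ * ε = h ^ 2 * ‖d‖ := by rw [hLε]; ring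
      _ ≤ 2 * h * ε := by linarith
  constructor
  · have h1 := hF.norm_gradient_sub_le hB hL0.le hL hseg
    have h2 : L * ‖d‖ ^ 2 ≤ 4 * ε := by
      have := mul_le_mul_of_nonneg_right hLN (norm_nonneg d)
      nlinarith
    -- The five terms, namely Taylor remainder, linear residual, regularization, gradient error and
    -- Hessian error, are at most `4 * ε`, `2 * μ * ε`, `4 * ε`, `ε / 3` and `ε / 9`.
    have h3 : gradient F (x + d) = (gradient F (x + d) - gradient F x - hess F x d) +
        ((Q + (2 * h) • ContinuousLinearMap.id ℝ (Vec n)) d + g) - (2 * h) • d -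
        (g - gradient F x) - (Q - hess F x) d := by
      simp only [add_apply, sub_apply, smul_apply, ContinuousLinearMap.id_apply]
      abel
    have h4 : ‖(2 * h) • d‖ = 2 * (h * ‖d‖) := by
      rw [norm_smul, Real.norm_of_nonneg (by positivity)]
      ring
    have h5 := (Q - hess F x).le_of_opNorm_le hQ d
    have h6 := mul_le_mul_of_nonneg_left hN hμ.le
    rw [h3]
    refine (norm_sub_le _ _).trans ?_
    refine (add_le_add_left ((norm_sub_le _ _).trans (add_le_add_left ((norm_sub_le _ _).trans
      (add_le_add_left (norm_add_le _ _) _)) _)) _).trans ?_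
    rw [h4]
    linarith
  · have h1 := hL _ hy _ hx
    rw [add_sub_cancel_left] at h1
    have h2 : ‖Q - hess F (x + d)‖ ≤ h / 18 + 2 * h := by
      have h3 := norm_sub_le_norm_sub_add_norm_sub Q (hess F x) (hess F (x + d))
      rw [norm_sub_rev] at h1
      linarith
    have h3 := curvature_bound_of_accurate hn hQs (hF.symmOp_hess hB hy) h2 hacc hcurv
    have : 0 < μ * h := by positivity
    linarith

/-- With accurate derivatives, an iteration either decreases the objective sufficiently or returns
an approximate second-order stationary point. -/
theorem Iteration.decrease_or_stationary (hn : 0 < n) (hF : TwiceDifferentiableOn F B)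
    (hB : IsOpen B) (hL0 : 0 < L) (hε : 0 < ε) (hη : 0 < η) (hμ : 0 < μ)
    (hL : ∀ x ∈ B, ∀ y ∈ B, ‖hess F x - hess F y‖ ≤ L * ‖x - y‖)
    (hg : ‖g - gradient F x‖ ≤ ε / 3) (hQ : ‖Q - hess F x‖ ≤ √(L * ε) / 18) (hQs : SymmOp Q)
    (hp : ‖p‖ = 1) (hacc : ⟪p, Q p⟫ - lamMin Q ≤ √(L * ε) / 2) {X' : Vec n ⊕ Vec n}
    (hit : Iteration L ε (√(L * ε)) μ η x g Q p d X')
    (hseg : segment ℝ x (x + d) ⊆ B) (hseg' : ∀ x', X' = Sum.inl x' → segment ℝ x x' ⊆ B) :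
    (∀ x', X' = Sum.inl x' → F x' ≤ F x - min (cNC L) (cSOL L η) * ε ^ (3 / 2 : ℝ)) ∧
    (∀ y, X' = Sum.inr y → ‖gradient F y‖ ≤ (2 * μ + 20) * ε ∧
      -((2 * μ + 20) * √(L * ε)) ≤ lamMin (hess F y)) := by
  have hpow : 0 ≤ ε ^ (3 / 2 : ℝ) := by positivity
  have hh0 : 0 < √(L * ε) := Real.sqrt_pos.2 (by positivity)
  cases hit with
  | nc σ hcurv hσ hsign =>
    refine ⟨fun x' hx' => ?_, fun y hy => by cases hy⟩
    obtain rfl := Sum.inl.inj hx'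
    refine (decrease_negativeCurvature hF hB hL0 hε hL hg hQ hp hcurv hσ hsign
      (hseg' _ rfl)).trans ?_
    have := mul_le_mul_of_nonneg_right (min_le_left (cNC L) (cSOL L η)) hpow
    linarith
  | sol j d hg' hcurv hd hres hlong =>
    refine ⟨fun x' hx' => ?_, fun y hy => by cases hy⟩
    obtain rfl := Sum.inl.inj hx'
    refine (decrease_newton hF hB hL0 hε hη hL hg hQ hQs hacc hcurv hd hlong
      (hseg' _ rfl)).trans ?_
    have := mul_le_mul_of_nonneg_right (min_le_right (cNC L) (cSOL L η)) hpow
    linarith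
  | stopSol j d hg' hcurv hd hres hshort =>
    refine ⟨fun x' hx' => (by cases hx'), fun y hy => ?_⟩
    obtain rfl := Sum.inr.inj hy
    exact stationary_of_short_newton hn hF hB hL0 hε hμ hL hg hQ hQs hacc hcurv hres hshort hseg
  | stopSmall hg' hcurv =>
    refine ⟨fun x' hx' => (by cases hx'), fun y hy => ?_⟩
    obtain rfl := Sum.inr.inj hy
    have hx : x ∈ B := hseg (left_mem_segment ℝ _ _)
    have h1 := curvature_bound_of_accurate hn hQs (hF.symmOp_hess hB hx) hQ hacc hcurv
    have h2 : ‖gradient F x‖ ≤ ‖g‖ + ‖g - gradient F x‖ := by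
      have := norm_sub_le g (g - gradient F x)
      rwa [sub_sub_cancel] at this
    have h3 : 0 < μ * ε := by positivity
    have h4 : 0 < μ * √(L * ε) := by positivity
    constructor <;> linarith

end OneIteration

/-! ### Runs that are accurate in every iteration -/

section Runs

/-- Fresh randomness, independent of the past, hits a set of conditional probability at least `q`
on any past event. -/
theorem mul_le_measure_inter_of_indep {Ω E Z : Type*} {m mΩ : MeasurableSpace Ω} {P : Measure Ω}
    [IsProbabilityMeasure P] [MeasurableSpace E] [MeasurableSpace Z] (hm : m ≤ mΩ) {X : Ω → E}
    (hX : Measurable[m] X) {S : Ω → Z} (hS : Measurable S)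
    (hind : Indep m (MeasurableSpace.comap S inferInstance) P) {W : Set (E × Z)}
    (hW : MeasurableSet W) {q : ENNReal} (hq : ∀ e, q ≤ P.map S {z | (e, z) ∈ W}) {A : Set Ω}
    (hA : MeasurableSet[m] A) : q * P A ≤ P (A ∩ {ω | (X ω, S ω) ∈ W}) := by
  -- Recording the event `A` as a coordinate makes the relevant past one random variable independent
  -- of `S`, so Tonelli's theorem applies to the product law.
  set Y : Ω → Prop × E := fun ω => (ω ∈ A, X ω) with hY
  have hYm : Measurable[m] Y := 
    Measurable.prodMk ((@measurableSet_setOfPred Ω m fun ω => ω ∈ A).1 hA) hX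
  have hYm' : Measurable Y := hYm.mono hm le_rfl
  have hindep : IndepFun Y S P := by
    rw [IndepFun_iff_Indep]
    exact indep_of_indep_of_le_left hind hYm.comap_le
  have hlaw := (indepFun_iff_map_prod_eq_prod_map_map hYm'.aemeasurable hS.aemeasurable).1 hindep
  have : IsProbabilityMeasure (P.map S) := Measure.isProbabilityMeasure_map hS.aemeasurable
  have h1 : MeasurableSet {a : Prop × E | a.1} := measurableSet_setOfPred.2 measurable_fst
  have hV : MeasurableSet {v : (Prop × E) × Z | v.1.1 ∧ (v.1.2, v.2) ∈ W} :=
    (h1.preimage measurable_fst).inter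
      (hW.preimage ((measurable_snd.comp measurable_fst).prodMk measurable_snd))
  have h2 : P (A ∩ {ω | (X ω, S ω) ∈ W}) =
      P.map (fun ω => (Y ω, S ω)) {v : (Prop × E) × Z | v.1.1 ∧ (v.1.2, v.2) ∈ W} := by
    rw [Measure.map_apply (hYm'.prodMk hS) hV]
    rfl
  have h3 : P A = P.map Y {a : Prop × E | a.1} := by
    rw [Measure.map_apply hYm' h1]
    rfl
  rw [h2, hlaw, Measure.prod_apply hV, h3, ← lintegral_indicator_const h1]
  refine lintegral_mono fun a => ?_
  by_cases ha : a.1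
  · simpa [Set.indicator, ha] using hq a.2
  · simp [Set.indicator, ha]

/-- The probability that every one of `K` rounds of fresh randomness hits its target, whenever
the target has probability at least `q` given the past. -/
theorem exists_measurableSet_forall_lt {Ω E : Type*} {mΩ : MeasurableSpace Ω} {P : Measure Ω}
    [IsProbabilityMeasure P] [MeasurableSpace E] {Z : ℕ → Type*} [∀ k, MeasurableSpace (Z k)]
    (ℱ : Filtration ℕ mΩ) {X : ℕ → Ω → E} (hX : ∀ k, Measurable[ℱ k] (X k))
    {S : (k : ℕ) → Ω → Z k} (hS : ∀ k, Measurable[ℱ (k + 1)] (S k))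
    (hind : ∀ k, Indep (ℱ k) (MeasurableSpace.comap (S k) inferInstance) P)
    {W : (k : ℕ) → Set (E × Z k)} (hW : ∀ k, MeasurableSet (W k)) {q : ENNReal} (hq : q ≤ 1)
    (K : ℕ) :
    ∃ A : Set Ω, MeasurableSet[ℱ K] A ∧ q ^ K ≤ P A ∧ ∀ ω ∈ A, ∀ k < K,
      q ≤ P.map (S k) {z | (X k ω, z) ∈ W k} → (X k ω, S k ω) ∈ W k := by
  induction K with
  | zero => exact ⟨Set.univ, MeasurableSet.univ, by simp, fun _ _ k hk => by omega⟩
  | succ K ih =>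
    obtain ⟨A, hA, hPA, hAω⟩ := ih
    have hSm : Measurable (S K) := (hS K).mono (ℱ.le _) le_rfl
    have : IsProbabilityMeasure (P.map (S K)) := Measure.isProbabilityMeasure_map hSm.aemeasurable
    set D : Set E := {e | q ≤ P.map (S K) {z | (e, z) ∈ W K}} with hD
    have hDm : MeasurableSet D := measurableSet_le measurable_const
      (measurable_measure_prodMk_left (hW K))
    -- The target becomes everything at states where it is not likely enough, so the lower bound `q
    -- ≤ 1` holds at every state.
    set W' : Set (E × Z K) := {v | v.1 ∈ D → v ∈ W K} with hW'
    have hW'm : MeasurableSet W' := by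
      have : W' = (Prod.fst ⁻¹' D)ᶜ ∪ W K := by
        ext v
        simp [hW', imp_iff_not_or]
      rw [this]
      exact ((hDm.preimage measurable_fst).compl).union (hW K)
    have hq' : ∀ e, q ≤ P.map (S K) {z | (e, z) ∈ W'} := fun e => by
      by_cases he : e ∈ D
      · have he' : q ≤ P.map (S K) {z | (e, z) ∈ W K} := he
        refine he'.trans (measure_mono fun z hz _ => hz)
      · simpa [hW', he] using hq
    refine ⟨A ∩ {ω | (X K ω, S K ω) ∈ W'}, ?_, ?_, ?_⟩
    · refine (ℱ.mono K.le_succ _ hA).inter ?_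
      exact (((hX K).mono (ℱ.mono K.le_succ) le_rfl).prodMk (hS K)) hW'm
    · have h1 := mul_le_measure_inter_of_indep (ℱ.le K) (hX K) hSm (hind K) hW'm hq' hA
      rw [pow_succ']
      exact (mul_le_mul_right hPA q).trans h1
    · rintro ω ⟨hω, hωW⟩ k hk hqk
      rcases Nat.lt_or_ge k K with h | h
      · exact hAω ω hω k h hqk
      · obtain rfl : k = K := by omega
        exact hωW hqk

variable {n m : ℕ} {f : Fin m → Vec n → ℝ}

/-- The derivatives that a pair of batches gives at `x` are accurate. -/
def AccurateBatches {s s' : ℕ} (f : Fin m → Vec n → ℝ) (ε h : ℝ)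
    (z : (Fin s → Fin m) × (Fin s' → Fin m)) (x : Vec n) : Prop :=
  ‖subGrad f z.1 x - gradient (finiteSum f) x‖ ≤ ε / 3 ∧
    ‖subHess f z.2 x - hess (finiteSum f) x‖ ≤ h / 18

theorem measurable_gradient (φ : Vec n → ℝ) : Measurable (gradient φ) :=
  (InnerProductSpace.toDual ℝ (Vec n)).symm.continuous.measurable.comp (measurable_fderiv ℝ φ)

/-- Derivatives of arbitrary functions are measurable here, so no smoothness outside `B` is
required. -/
theorem measurableSet_accurateBatches {s s' : ℕ} (ε h : ℝ)
    (z : (Fin s → Fin m) × (Fin s' → Fin m)) :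
    MeasurableSet {x | AccurateBatches f ε h z x} := by
  have h1 : Measurable (subGrad f z.1) :=
    (Finset.measurable_fun_sum _ fun j _ => measurable_gradient (f (z.1 j))).fun_const_smul _
  have h2 : Measurable (subHess f z.2) :=
    (Finset.measurable_fun_sum _ fun j _ => measurable_fderiv ℝ (gradient (f (z.2 j)))).fun_const_smul _
  exact (measurableSet_le (h1.sub (measurable_gradient _)).norm measurable_const).inter
    (measurableSet_le (h2.sub (measurable_fderiv ℝ _)).norm measurable_const)

theorem le_measure_of_compl_le {Ω : Type*} {mΩ : MeasurableSpace Ω} {P : Measure Ω}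
    [IsProbabilityMeasure P] {E : Set Ω} (hE : MeasurableSet E) {t : ℝ} (ht : 0 ≤ t)
    (h : P Eᶜ ≤ ENNReal.ofReal t) : ENNReal.ofReal (1 - t) ≤ P E := by
  rw [ENNReal.ofReal_sub _ ht, ENNReal.ofReal_one, tsub_le_iff_right,
    ← prob_add_prob_compl (μ := P) hE]
  exact add_le_add_right h _

/-- At a point of the level set, fresh batches are accurate with probability at least `1 - δ`. -/
theorem le_map_accurateBatches (hn : 0 < n) (hm : 0 < m) {B : Set (Vec n)} (hB : IsOpen B)
    (hf : ∀ i, TwiceDifferentiableOn (f i) B) {x : Vec n} (hx : x ∈ B) {Ug Uh ε h δ : ℝ}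
    (hUg : 0 < Ug) (hUh : 0 < Uh) (hε : 0 < ε) (hh : 0 < h) (hδ : 0 < δ) (hδ1 : δ < 1)
    (hg : ∀ i, ‖gradient (f i) x‖ ≤ Ug) (hH : ∀ i, ‖hess (f i) x‖ ≤ Uh) (T : Sampling) {s s' : ℕ}
    (hs : 9 * Ug ^ 2 * (1 + √(8 * Real.log (1 / δ))) ^ 2 / ε ^ 2 ≤ (s : ℝ))
    (hs' : 5184 * Uh ^ 2 / h ^ 2 * Real.log (2 * (n : ℝ) / δ) ≤ (s' : ℝ))
    {Ω : Type*} {mΩ : MeasurableSpace Ω} {P : Measure Ω} [IsProbabilityMeasure P]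
    {Sg : Ω → (Fin s → Fin m)} {Sh : Ω → (Fin s' → Fin m)} (hSg : Measurable Sg)
    (hSh : Measurable Sh) (hind : IndepFun Sg Sh P)
    (hlg : P.map Sg = uniformOn (T.batches s m)) (hlh : P.map Sh = uniformOn (T.batches s' m)) :
    ENNReal.ofReal (1 - δ) ≤
      P.map (fun ω => (Sg ω, Sh ω)) {z | AccurateBatches f ε h z x} := by
  have hP1 : IsProbabilityMeasure (P.map Sg) := Measure.isProbabilityMeasure_map hSg.aemeasurable
  have hP2 : IsProbabilityMeasure (P.map Sh) := Measure.isProbabilityMeasure_map hSh.aemeasurable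
  rw [(indepFun_iff_map_prod_eq_prod_map_map hSg.aemeasurable hSh.aemeasurable).1 hind]
  set Eg : Set (Fin s → Fin m) := {S | ‖subGrad f S x - gradient (finiteSum f) x‖ ≤ ε / 3}
  set Eh : Set (Fin s' → Fin m) := {S | ‖subHess f S x - hess (finiteSum f) x‖ ≤ h / 18}
  have hE : {z | AccurateBatches f ε h z x} = Eg ×ˢ Eh := rfl
  rw [hE, Measure.prod_prod]
  have h1 : ENNReal.ofReal (1 - δ ^ 4) ≤ P.map Sg Eg := by
    refine le_measure_of_compl_le (Set.toFinite Eg).measurableSet (by positivity) ?_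
    rw [hlg]
    refine le_trans (measure_mono fun S hS => ?_) (T.uniformOn_norm_mean_sub_le hm
      (fun i => gradient (f i) x) hUg hε hδ hδ1 hg hs)
    rw [← gradient_finiteSum hf hB hx]
    have h0 : ¬ ‖subGrad f S x - gradient (finiteSum f) x‖ ≤ ε / 3 := hS
    exact not_le.1 h0
  have h2 : ENNReal.ofReal (1 - δ ^ 4 / 8) ≤ P.map Sh Eh := by
    refine le_measure_of_compl_le (Set.toFinite Eh).measurableSet (by positivity) ?_
    rw [hlh]
    refine le_trans (measure_mono fun S hS => ?_) (T.uniformOn_opNorm_mean_sub_le hn hm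
      (fun i => hess (f i) x) (fun i => (hf i).symmOp_hess hB hx) hUh hh hδ hδ1 hH hs')
    rw [← hess_finiteSum hf hB hx]
    have h0 : ¬ ‖subHess f S x - hess (finiteSum f) x‖ ≤ h / 18 := hS
    exact not_le.1 h0
  have h3 : δ ^ 4 < 1 := pow_lt_one₀ hδ.le hδ1 (by norm_num)
  calc ENNReal.ofReal (1 - δ) ≤ ENNReal.ofReal ((1 - δ ^ 4) * (1 - δ ^ 4 / 8)) := by
        refine ENNReal.ofReal_le_ofReal ?_
        -- The difference of the two sides is `(1 - δ) * δ * (1 - δ / 8 - δ ^ 2 / 8)`.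
        have e1 : 1 - δ ≤ (1 - δ ^ 2) * (1 - δ ^ 2 / 8) := by
          have := mul_nonneg (mul_nonneg (sub_nonneg.2 hδ1.le) hδ.le)
            (show 0 ≤ 1 - δ / 8 - δ ^ 2 / 8 by nlinarith)
          linarith
        have e2 : δ ^ 4 ≤ δ ^ 2 := pow_le_pow_of_le_one hδ.le hδ1.le (by norm_num)
        have e3 : 0 ≤ 1 - δ ^ 2 := by nlinarith
        refine e1.trans (mul_le_mul (by linarith) (by linarith) (by linarith) (by linarith))
    _ = ENNReal.ofReal (1 - δ ^ 4) * ENNReal.ofReal (1 - δ ^ 4 / 8) :=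
        ENNReal.ofReal_mul (by linarith)
    _ ≤ _ := mul_le_mul' h1 h2

end Runs

/-! ### The complexity bound -/

section Complexity

theorem cNC_pos {L : ℝ} (hL : 0 < L) : 0 < cNC L := by
  have := Real.sqrt_pos.2 hL
  unfold cNC
  positivity

theorem cSOL_pos {L η : ℝ} (hL : 0 < L) (hη : 0 < η) : 0 < cSOL L η := by
  unfold cSOL
  positivity

/-- The `+ 1` in the iteration bound makes the inequality strict even for `Δ = 0`. -/
theorem lt_iterBound_mul {L η Δ ε : ℝ} (hL : 0 < L) (hη : 0 < η) (hε : 0 < ε) (hΔ : 0 ≤ Δ) :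
    Δ < iterBound L η Δ ε * (min (cNC L) (cSOL L η) * ε ^ (3 / 2 : ℝ)) := by
  set c := min (cNC L) (cSOL L η) with hc
  have hc0 : 0 < c := lt_min (cNC_pos hL) (cSOL_pos hL hη)
  have he0 : 0 < ε ^ (3 / 2 : ℝ) := by positivity
  have h1 : 2 * Δ / c * ε ^ (-(3 / 2) : ℝ) + 1 ≤ iterBound L η Δ ε := by
    rw [iterBound]
    push_cast
    exact add_le_add_left (Nat.le_ceil _) 1
  have h2 := mul_le_mul_of_nonneg_right h1 (mul_pos hc0 he0).le
  have h3 : (2 * Δ / c * ε ^ (-(3 / 2) : ℝ) + 1) * (c * ε ^ (3 / 2 : ℝ)) =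
      2 * Δ + c * ε ^ (3 / 2 : ℝ) := by
    rw [Real.rpow_neg hε.le]
    field_simp
  rw [h3] at h2
  have := mul_pos hc0 he0
  linarith

theorem symmOp_subHess {n m s : ℕ} {f : Fin m → Vec n → ℝ} {B : Set (Vec n)} (hB : IsOpen B)
    (hf : ∀ i, TwiceDifferentiableOn (f i) B) {x : Vec n} (hx : x ∈ B) (S : Fin s → Fin m) :
    SymmOp (subHess f S x) :=
  (SymmOp.sum _ fun j _ => (hf (S j)).symmOp_hess hB hx).smul _

/-- A run whose derivatives are accurate on the level set decreases the objective until it returns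
an approximate second-order stationary point. -/
theorem SubsampledRun.decrease_or_stationary {n m : ℕ} (hn : 0 < n) {f : Fin m → Vec n → ℝ}
    {x₀ : Vec n} {L ε μ η : ℝ} {T : Sampling} {sg sh : ℕ → ℕ} {Ω : Type*} {mΩ : MeasurableSpace Ω}
    {P : Measure Ω} (R : SubsampledRun f x₀ L ε (√(L * ε)) μ η T sg sh P) (hL0 : 0 < L)
    (hε : 0 < ε) (hη : 0 < η) (hμ : 0 < μ) {B : Set (Vec n)} (hB : IsOpen B) (hR : R.StaysIn B)
    (hf : ∀ i, TwiceDifferentiableOn (f i) B)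
    (hL : ∀ x ∈ B, ∀ y ∈ B,
      ‖hess (finiteSum f) x - hess (finiteSum f) y‖ ≤ L * ‖x - y‖)
    (hE : R.EigAccurate) {ω : Ω} {K : ℕ}
    (hacc : ∀ k < K, ∀ x ∈ B, R.X k ω = Sum.inl x → finiteSum f x ≤ finiteSum f x₀ →
      AccurateBatches f ε (√(L * ε)) (R.Sg k ω, R.Sh k ω) x) :
    ∀ k ≤ K, (∃ x, R.X k ω = Sum.inl x ∧ finiteSum f x ≤
        finiteSum f x₀ - k * (min (cNC L) (cSOL L η) * ε ^ (3 / 2 : ℝ))) ∨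
      ∃ y, R.X k ω = Sum.inr y ∧ ‖gradient (finiteSum f) y‖ ≤ (2 * μ + 20) * ε ∧
        -((2 * μ + 20) * √(L * ε)) ≤ lamMin (hess (finiteSum f) y) := by
  intro k
  induction k with
  | zero => exact fun _ => Or.inl ⟨x₀, R.start ω, by simp⟩
  | succ k ih =>
    intro hk
    rcases ih (by omega) with ⟨x, hx, hdec⟩ | ⟨y, hy, hgood⟩
    · have hc0 : 0 < min (cNC L) (cSOL L η) * ε ^ (3 / 2 : ℝ) :=
        mul_pos (lt_min (cNC_pos hL0) (cSOL_pos hL0 hη)) (by positivity)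
      obtain ⟨hseg, hseg'⟩ := hR k ω x hx
      have hxB : x ∈ B := hseg (left_mem_segment ℝ _ _)
      -- The decrease so far keeps the iterate in the level set, where accuracy is available.
      have hlev : finiteSum f x ≤ finiteSum f x₀ := by
        have : 0 ≤ (k : ℝ) * (min (cNC L) (cSOL L η) * ε ^ (3 / 2 : ℝ)) := by positivity
        linarith
      obtain ⟨hg, hQ⟩ := hacc k (by omega) x hxB hx hlev
      obtain ⟨hp, hlam⟩ := hE k ω x hx
      obtain ⟨h1, h2⟩ := (R.step k ω x hx).decrease_or_stationary hn
        (twiceDifferentiableOn_finiteSum hf hB) hB hL0 hε hη hμ hL hg hQ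
        (symmOp_subHess hB hf hxB _) hp hlam hseg hseg'
      rcases hX : R.X (k + 1) ω with x' | y
      · refine Or.inl ⟨x', rfl, ?_⟩
        have := h1 x' hX
        push_cast
        linarith
      · exact Or.inr ⟨y, rfl, h2 y hX⟩
    · exact Or.inr ⟨y, R.stay k ω y hy, hgood⟩

end Complexity

theorem mainTheorem9 (μ : ℝ) (hμ : 0 < μ) :
    ∃ C : ℝ, 0 < C ∧
      ∀ (n m : ℕ) (_hn : 0 < n) (_hm : 0 < m) (f : Fin m → Vec n → ℝ) (x₀ : Vec n)
        (fstar Lg Lh ε η δ Ug Uh : ℝ) (B : Set (Vec n)) (T : Sampling) (sg sh : ℕ → ℕ)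
        (Ω : Type*) (mΩ : MeasurableSpace Ω) (P : Measure Ω) (_hP : IsProbabilityMeasure P)
        (R : SubsampledRun f x₀ Lh ε (√(Lh * ε)) μ η T sg sh P),
        0 < Lg → 0 < Lh → 0 < ε → 0 < η → 0 < δ → δ < 1 → 0 < Ug → 0 < Uh →
        -- `f` is bounded below, and its level set is bounded
        (∀ x, fstar ≤ finiteSum f x) →
        Bornology.IsBounded {x | finiteSum f x ≤ finiteSum f x₀} →
        -- the gradient and the Hessian of `f` are Lipschitz on an open set that holds the segments
        IsOpen B → R.StaysIn B →
        (∀ i, TwiceDifferentiableOn (f i) B) →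
        (∀ x ∈ B, ∀ y ∈ B,
          ‖gradient (finiteSum f) x - gradient (finiteSum f) y‖ ≤ Lg * ‖x - y‖) →
        (∀ x ∈ B, ∀ y ∈ B,
          ‖hess (finiteSum f) x - hess (finiteSum f) y‖ ≤ Lh * ‖x - y‖) →
        -- accuracy of the approximate eigenvectors
        R.EigAccurate →
        -- bounds on the level set, and the batch sizes
        (∀ i x, finiteSum f x ≤ finiteSum f x₀ → ‖gradient (f i) x‖ ≤ Ug) →
        (∀ i x, finiteSum f x ≤ finiteSum f x₀ → ‖hess (f i) x‖ ≤ Uh) →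
        (∀ k, 9 * Ug ^ 2 * (1 + √(8 * Real.log (1 / δ))) ^ 2 / ε ^ 2 ≤ (sg k : ℝ)) →
        (∀ k, 5184 * Uh ^ 2 / (√(Lh * ε)) ^ 2 * Real.log (2 * (n : ℝ) / δ) ≤ (sh k : ℝ)) →
        -- with the stated probability, the method returns an approximate second-order
        -- stationary point within `iterBound` iterations
        ∃ A : Set Ω, MeasurableSet A ∧
          ENNReal.ofReal ((1 - δ) ^ iterBound Lh η (finiteSum f x₀ - fstar) ε) ≤ P A ∧
          ∀ ω ∈ A, ∃ y : Vec n,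
            R.X (iterBound Lh η (finiteSum f x₀ - fstar) ε) ω = Sum.inr y ∧
            ‖gradient (finiteSum f) y‖ ≤ C * ε ∧
            -(C * √(Lh * ε)) ≤ lamMin (hess (finiteSum f) y) := by
  -- The `2 * μ` pays for the linear residual at a short direction; `20` generously covers all other
  -- errors.
  refine ⟨2 * μ + 20, by positivity, ?_⟩
  intro n m hn hm f x₀ fstar Lg Lh ε η δ Ug Uh B T sg sh Ω mΩ P hP R _ hLh hε hη hδ hδ1 hUg hUh
    hbelow _ hB hR hf _ hL hE hgU hHU hsg hsh
  set Δ := finiteSum f x₀ - fstar with hΔ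
  set K := iterBound Lh η Δ ε with hK
  have hh0 : 0 < √(Lh * ε) := Real.sqrt_pos.2 (by positivity)
  have hSgm : ∀ k, Measurable (R.Sg k) := fun k => (R.measurable_Sg k).mono (R.ℱ.le _) le_rfl
  have hShm : ∀ k, Measurable (R.Sh k) := fun k => (R.measurable_Sh k).mono (R.ℱ.le _) le_rfl
  obtain ⟨A, hA, hPA, hAω⟩ := exists_measurableSet_forall_lt (P := P) R.ℱ R.measurable_X
    (S := fun k ω => (R.Sg k ω, R.Sh k ω))
    (fun k => (R.measurable_Sg k).prodMk (R.measurable_Sh k)) R.indep_past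
    -- Nothing is asked of the batches once the method has returned.
    (W := fun k => {v | Sum.elim (AccurateBatches f ε (√(Lh * ε)) v.2) (fun _ => True) v.1})
    (fun k => by
      refine measurableSet_setOfPred.2 (measurable_from_prod_countable_left fun z => ?_)
      exact (measurableSet_setOfPred.1 (measurableSet_accurateBatches ε (√(Lh * ε)) z)).sumElim
        measurable_const)
    (q := ENNReal.ofReal (1 - δ)) (by simpa using hδ.le) K
  refine ⟨A, R.ℱ.le K A hA, ?_, fun ω hω => ?_⟩
  · rwa [ENNReal.ofReal_pow (by linarith)]
  have hacc : ∀ k < K, ∀ x ∈ B, R.X k ω = Sum.inl x → finiteSum f x ≤ finiteSum f x₀ →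
      AccurateBatches f ε (√(Lh * ε)) (R.Sg k ω, R.Sh k ω) x := fun k hk x hxB hx hlev => by
    have h1 := hAω ω hω k hk
    rw [hx] at h1
    exact h1 (le_map_accurateBatches hn hm hB hf hxB hUg hUh hε hh0 hδ hδ1
      (fun i => hgU i x hlev) (fun i => hHU i x hlev) T (hsg k) (hsh k) (hSgm k) (hShm k)
      (R.indep_batches k) (R.law_Sg k) (R.law_Sh k))
  rcases R.decrease_or_stationary hn hLh hε hη hμ hB hR hf hL hE hacc K le_rfl with
    ⟨x, _, hx⟩ | hgood
  -- Still running after `K` decreasing steps would put the objective below `fstar`.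
  · have h1 := lt_iterBound_mul hLh hη hε (sub_nonneg.2 (hbelow x₀))
    have h2 := hbelow x
    linarith
  · exact hgood
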